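/- All groups and graphs are finite; graphs are simple and undirected. For a group $G$ and $S=S^{-1}\subseteq G\setminus\{1\}$, $\mathrm{Cay}(G,S)$ is the graph with vertex set $G$ and edges $\{g,sg\}$ ($g\in G$, $s\in S$). For a group $H$ and subsets $R=R^{-1}$, $L=L^{-1}$, $S$ of $H$ with $1\notin R\cup L$, the bi-Cayley graph $\mathrm{BiCay}(H,R,L,S)$ has vertex set $\{h_0: h\in H\}\sqcup\{h_1: h\in H\}$ and edges $\{h_0,g_0\}$ with $gh^{-1}\in R$, $\{h_1,g_1\}$ with $gh^{-1}\in L$, and $\{h_0,g_1\}$ with $gh^{-1}\in S$. The permutations $BR(g): h_i\mapsto (hg)_i$ form a subgroup $BR(H)$ of its automorphism group; if $BR(H)$ is normal in the full automorphism group, the graph (and any graph isomorphic to it) is called a normal bi-Cayley graph over $H$. $X\square Y$ denotes the Cartesian product of graphs. **Lemma.** Let $G$ be one of the thirteen groups (up to isomorphism) 1. $\mathbb Z_2^2,\ \mathbb Z_2^3,\ \mathbb Z_2^4$; 2. the dihedral groups $D_6, D_8, D_{10}$ of orders $6,8,10$; 3. $\mathrm{Alt}(4)$; 4. $\langle a,b,c\mid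 a^2=b^2=c^2=1,\ abc=bca=cab\rangle$; 5. $\langle a,b\mid a^8=b^2=1,\ bab=a^5\rangle$; 6. $\langle a,b,c\mid a^3=b^3=c^2=1,\ ab=ba,\ (ac)^2=(bc)^2=1\rangle$; 7. $\langle a,b,c\mid a^3=b^3=c^3=1,\ ac=ca,\ bc=cb,\ c=a^{-1}b^{-1}ab\rangle$; 8. $Q_8\times\mathbb Z_3,\ Q_8\times\mathbb Z_4$. Then $G$ has a connected normal bi-Cayley graph. More precisely, the following graphs are connected normal bi-Cayley graphs over the respective groups: 1. the hypercube $Q_{n+1}$ over $\mathbb Z_2^n$, for $n=2,3,4$; 2. the prism $C_{2n}\square K_2$ over $D_{2n}$, for $n=3,4,5$, where $C_{2n}$ is the cycle of length $2n$; 3. $\mathrm{Cay}(\mathrm{Alt}(4),\{(1\,2\,3),(1\,3\,2),(1\,2\,4),(1\,4\,2)\})\square K_2$ over $\mathrm{Alt}(4)$; 4. $\mathrm{Cay}(G,\{a,b,c\})\square K_2$ over the group $G$ in (4); 5. $\mathrm{Cay}(G,\{a,a^{-1},b,a^4,a^4b\})\square K_2$ over the group $G$ in (5); 6. $\mathrm{Cay}(G,\{c,ca,cb,cab\})\square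 K_2$ over the group $G$ in (6); 7. $\mathrm{Cay}(G,\{a,b,a^{-1},b^{-1}\})\square K_2$ over the group $G$ in (7); 8. $\mathrm{GP}(8,3)\square C_n$ over $Q_8\times\mathbb Z_n$, for $n=3,4$, where $\mathrm{GP}(8,3)$ is the graph with vertices $i,i'$ ($i\in\mathbb Z_8$) and edges $\{i,i+1\}$, $\{i',(i+3)'\}$, $\{i,i'\}$, and $C_n$ is the cycle of length $n$. -/

import Mathlib

open scoped SimpleGraph

/-! ### Cayley and bi-Cayley graphs -/

/-- The Cayley graph `Cay(G, S)`: vertex set `G`, edge set `{ {g, s g} : g ∈ G, s ∈ S }`.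
Only used for `1 ∉ S`. For `S` inverse-closed this is the usual Cayley graph; for arbitrary `S`
it is `Cay(G, S ∪ S⁻¹)`, as edges are unordered. -/
def cayGraph {G : Type*} [Group G] (S : Set G) : SimpleGraph G :=
  SimpleGraph.fromRel fun g h => h * g⁻¹ ∈ S

/-- The edges of `BiCay(H, R, L, S)`: the right edges `{h₀, g₀}` with `g h⁻¹ ∈ R`, the left edges
`{h₁, g₁}` with `g h⁻¹ ∈ L`, and the spokes `{h₀, g₁}` with `g h⁻¹ ∈ S`.
Here `h₀` is `Sum.inl h` and `h₁` is `Sum.inr h`. -/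
def biCayRel {H : Type*} [Group H] (R L S : Set H) : H ⊕ H → H ⊕ H → Prop
  | .inl h, .inl g => g * h⁻¹ ∈ R
  | .inr h, .inr g => g * h⁻¹ ∈ L
  | .inl h, .inr g => g * h⁻¹ ∈ S
  | .inr _, .inl _ => False

/-- The bi-Cayley graph `BiCay(H, R, L, S)`. -/
def biCayGraph {H : Type*} [Group H] (R L S : Set H) : SimpleGraph (H ⊕ H) :=
  SimpleGraph.fromRel (biCayRel R L S)

/-- Admissible triples `(R, L, S)`: `R⁻¹ = R`, `L⁻¹ = L` and `1 ∉ R ∪ L`. -/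
structure IsBiCayTriple {H : Type*} [Group H] (R L S : Set H) : Prop where
  inv_right : ∀ x ∈ R, x⁻¹ ∈ R
  inv_left : ∀ x ∈ L, x⁻¹ ∈ L
  one_notMem : (1 : H) ∉ R ∪ L

/-- The subgroup `BR(H) = {BR(g) : g ∈ H}` of `Aut(BiCay(H, R, L, S))`, where
`BR(g) : h₀ ↦ (h g)₀, h₁ ↦ (h g)₁`. -/
def biCayBR {H : Type*} [Group H] (R L S : Set H) :
    Subgroup (biCayGraph R L S ≃g biCayGraph R L S) where
  carrier := {φ | ∃ g : H, ∀ h : H, φ (.inl h) = .inl (h * g) ∧ φ (.inr h) = .inr (h * g)}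
  one_mem' := ⟨1, fun h => by simp⟩
  mul_mem' := by
    rintro φ ψ ⟨g, hg⟩ ⟨k, hk⟩
    refine ⟨k * g, fun h => ?_⟩
    simp [hg, hk, mul_assoc]
  inv_mem' := by
    rintro φ ⟨g, hg⟩
    refine ⟨g⁻¹, fun h => ?_⟩
    constructor
    · rw [← (hg (h * g⁻¹)).1.trans (by simp : _ = Sum.inl h), RelIso.inv_apply_self]
    · rw [← (hg (h * g⁻¹)).2.trans (by simp : _ = Sum.inr h), RelIso.inv_apply_self]

/-- Right multiplication by `g` on both copies of `H`, as an automorphism of the graph. -/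
def biCayBRIso {H : Type*} [Group H] (R L S : Set H) (g : H) :
    biCayGraph R L S ≃g biCayGraph R L S where
  toEquiv := Equiv.sumCongr (Equiv.mulRight g) (Equiv.mulRight g)
  map_rel_iff' := by
    rintro (x | x) (y | y) <;> simp [biCayGraph, biCayRel]

/-- Every `BR(g)` is an automorphism, so that `biCayBR` is all of `BR(H)`. -/
theorem biCayBRIso_mem {H : Type*} [Group H] (R L S : Set H) (g : H) :
    biCayBRIso R L S g ∈ biCayBR R L S :=
  ⟨g, fun _ => ⟨rfl, rfl⟩⟩

/-- `Γ` is a connected normal bi-Cayley graph over `H`: it is connected and (up to isomorphism)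
of the form `BiCay(H, R, L, S)` with `BR(H)` normal in the full automorphism group. -/
def IsConnectedNormalBiCayley (H : Type*) [Group H] {V : Type*} (Γ : SimpleGraph V) : Prop :=
  Γ.Connected ∧ ∃ R L S : Set H, IsBiCayTriple R L S ∧ (biCayBR R L S).Normal ∧
    Nonempty (Γ ≃g biCayGraph R L S)

/-! ### The graphs -/

/-- The complete graph on two vertices. -/
abbrev graphK2 : SimpleGraph (Fin 2) := ⊤

/-- The `n`-dimensional hypercube: two `n`-tuples are adjacent iff they differ in exactly one
place. -/
def hypercube (n : ℕ) : SimpleGraph (Fin n → Bool) where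
  Adj x y := ∃! i, x i ≠ y i
  symm := ⟨fun x y h => by simpa only [ne_comm] using h⟩
  loopless := ⟨fun x h => by obtain ⟨i, hi, -⟩ := h; exact hi rfl⟩

/-- The Möbius–Kantor graph `GP(8, 3)`; the outer vertex `i` is `Sum.inl i`, the inner vertex `i'`
is `Sum.inr i`. Edges `{i, i+1}`, `{i', (i+3)'}` and `{i, i'}`. -/
def graphGP83 : SimpleGraph (ZMod 8 ⊕ ZMod 8) :=
  SimpleGraph.fromRel fun
    | .inl i, .inl j => j = i + 1
    | .inr i, .inr j => j = i + 3
    | .inl i, .inr j => j = i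
    | .inr _, .inl _ => False

/-! ### The thirteen exceptional groups -/

/-- The elementary abelian group `ℤ₂ⁿ`, written multiplicatively. -/
abbrev ElemAb2 (n : ℕ) : Type := Multiplicative (Fin n → ZMod 2)

/-- The cyclic group `ℤₙ`, written multiplicatively. -/
abbrev Cyc (n : ℕ) : Type := Multiplicative (ZMod n)

/-- `a² = b² = c² = 1`, `abc = bca = cab`. -/
def relsE4 : Set (FreeGroup (Fin 3)) :=
  let a := FreeGroup.of 0
  let b := FreeGroup.of 1
  let c := FreeGroup.of 2
  {a ^ 2, b ^ 2, c ^ 2, (a * b * c) * (b * c * a)⁻¹, (b * c * a) * (c * a * b)⁻¹}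

/-- `a⁸ = b² = 1`, `bab = a⁵`. -/
def relsE5 : Set (FreeGroup (Fin 2)) :=
  let a := FreeGroup.of 0
  let b := FreeGroup.of 1
  {a ^ 8, b ^ 2, (b * a * b) * (a ^ 5)⁻¹}

/-- `a³ = b³ = c² = 1`, `ab = ba`, `(ac)² = (bc)² = 1`. -/
def relsE6 : Set (FreeGroup (Fin 3)) :=
  let a := FreeGroup.of 0
  let b := FreeGroup.of 1
  let c := FreeGroup.of 2
  {a ^ 3, b ^ 3, c ^ 2, (a * b) * (b * a)⁻¹, (a * c) ^ 2, (b * c) ^ 2}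

/-- `a³ = b³ = c³ = 1`, `ac = ca`, `bc = cb`, `c = a⁻¹b⁻¹ab`. -/
def relsE7 : Set (FreeGroup (Fin 3)) :=
  let a := FreeGroup.of 0
  let b := FreeGroup.of 1
  let c := FreeGroup.of 2
  {a ^ 3, b ^ 3, c ^ 3, (a * c) * (c * a)⁻¹, (b * c) * (c * b)⁻¹, c * (a⁻¹ * b⁻¹ * a * b)⁻¹}

abbrev GroupE4 : Type := PresentedGroup relsE4
abbrev GroupE5 : Type := PresentedGroup relsE5
abbrev GroupE6 : Type := PresentedGroup relsE6
abbrev GroupE7 : Type := PresentedGroup relsE7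

/-- `G` is isomorphic to one of the thirteen exceptional groups; `DihedralGroup n` has order `2n`,
and `QuaternionGroup 2` is the quaternion group of order `8`. -/
inductive IsClassE (G : Type*) [Group G] : Prop
  | elemAb (n : ℕ) (hn : n = 2 ∨ n = 3 ∨ n = 4) (e : G ≃* ElemAb2 n)
  | dihedral (n : ℕ) (hn : n = 3 ∨ n = 4 ∨ n = 5) (e : G ≃* DihedralGroup n)
  | alt4 (e : G ≃* alternatingGroup (Fin 4))
  | e4 (e : G ≃* GroupE4)
  | e5 (e : G ≃* GroupE5)
  | e6 (e : G ≃* GroupE6)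
  | e7 (e : G ≃* GroupE7)
  | quat (n : ℕ) (hn : n = 3 ∨ n = 4) (e : G ≃* QuaternionGroup 2 × Cyc n)

/-! ### The connection sets -/

/-- `{(1 2 3), (1 3 2), (1 2 4), (1 4 2)}` in `Alt(4)`, with the points renamed `0, 1, 2, 3`. -/
def connA4 : Set (alternatingGroup (Fin 4)) :=
  {x | (x : Equiv.Perm (Fin 4)) ∈
    ({c[0, 1, 2], c[0, 2, 1], c[0, 1, 3], c[0, 3, 1]} : Set (Equiv.Perm (Fin 4)))}

/-- `{a, b, c}`. -/
def connE4 : Set GroupE4 :=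
  let a : GroupE4 := PresentedGroup.of 0
  let b : GroupE4 := PresentedGroup.of 1
  let c : GroupE4 := PresentedGroup.of 2
  {a, b, c}

/-- `{a, a⁻¹, b, a⁴, a⁴b}`. -/
def connE5 : Set GroupE5 :=
  let a : GroupE5 := PresentedGroup.of 0
  let b : GroupE5 := PresentedGroup.of 1
  {a, a⁻¹, b, a ^ 4, a ^ 4 * b}

/-- `{c, ca, cb, cab}`. -/
def connE6 : Set GroupE6 :=
  let a : GroupE6 := PresentedGroup.of 0
  let b : GroupE6 := PresentedGroup.of 1
  let c : GroupE6 := PresentedGroup.of 2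
  {c, c * a, c * b, c * a * b}

/-- `{a, b, a⁻¹, b⁻¹}`. -/
def connE7 : Set GroupE7 :=
  let a : GroupE7 := PresentedGroup.of 0
  let b : GroupE7 := PresentedGroup.of 1
  {a, b, a⁻¹, b⁻¹}

/-! Every graph here has at most 64 vertices, so normality of `BR(H)` can be settled by running
through automorphisms. Two reductions keep the search small. Since `BR(H)` is transitive on each of
the two copies of `H`, every automorphism becomes, after composition with some `BR(g)`, one that
sends `1₀` to `1₀` or `1₁`; it is enough that these normalize `BR(H)`. And for such an automorphism
only conjugates of generators need testing.

The search is a backtracking one: vertices are treated in an order in which each has an earlier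
neighbour, so its image must lie among the few neighbours of an image already chosen. Partial maps
that are not injective or lose an edge are pruned. The search may also meet maps that are not
automorphisms; what matters is `extendAll_sound`: every automorphism with the prescribed start is
the map at some leaf. If all leaves pass the test, `biCayBR_normal_of_forall` gives normality
(`BiCayCode.Valid.normal`). That the order reaches every vertex also proves connectedness.

The numerical graph is tied to the actual one by a numbering of the group compatible with
multiplication (`IsGroupCode`). For a concrete group this is a finite check. For a presented group,
the relations give a product formula for normal forms, and a permutation representation separates
them, so that its order need not be known beforehand (`IsGroupCode.of_presentedGroup`). Prisms over
Cayley graphs are bi-Cayley with spoke set `{1}`; the remaining graphs are matched by explicit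
numberings of their vertices. -/

/-! ### Exhaustive search for the automorphisms of a coded graph

Vertices are numbered `0, 1, …, N - 1` with `N ≤ 64`. A map between vertex sets is stored as a
natural number in base `64`, and neighbour lists as blocks of such digits. The functions are
written with the arithmetic operations on `ℕ` which the kernel evaluates directly. -/

/-- `f x`, written so that the kernel evaluates `x` first. -/
def withValue (x : ℕ) (f : ℕ → Bool) : Bool :=
  Nat.rec (f 0) (fun k _ => f (Nat.succ k)) x

theorem withValue_eq (x : ℕ) (f : ℕ → Bool) : withValue x f = f x := by
  cases x <;> rfl

/-- The digit of `A` in base `64` at place `v`. -/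
def digit (A v : ℕ) : ℕ := Nat.mod (Nat.shiftRight A (Nat.mul 6 v)) 64

/-- Write the digit `w` at the empty place `v` of `A`. -/
def setDigit (A v w : ℕ) : ℕ := Nat.lor A (Nat.shiftLeft w (Nat.mul 6 v))

/-- Membership in the set of natural numbers with characteristic bits `U`. -/
def hasBit (U w : ℕ) : Bool := Nat.beq (Nat.mod (Nat.shiftRight U w) 2) 1

theorem hasBit_eq_testBit (U w : ℕ) : hasBit U w = U.testBit w := by
  have h : hasBit U w = decide ((U >>> w) % 2 = 1) := by
    rw [Bool.eq_iff_iff, decide_eq_true_iff]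
    exact Iff.of_eq Nat.beq_eq
  rw [h, ← Nat.testBit_zero, Nat.testBit_shiftRight, Nat.add_zero]

theorem testBit_digit (A v i : ℕ) :
    (digit A v).testBit i = (decide (i < 6) && A.testBit (6 * v + i)) := by
  have h : digit A v = (A >>> (6 * v)) % 2 ^ 6 := rfl
  rw [h, Nat.testBit_mod_two_pow, Nat.testBit_shiftRight]

theorem testBit_setDigit (A v w i : ℕ) :
    (setDigit A v w).testBit i = (A.testBit i || (decide (6 * v ≤ i) && w.testBit (i - 6 * v))) := by
  have h : setDigit A v w = A ||| (w <<< (6 * v)) := rfl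
  rw [h, Nat.testBit_or, Nat.testBit_shiftLeft]

/-- Writing is a bitwise or, hence the place must still hold zero; `w < 64` keeps the bits of `w`
inside the six bits of its place. -/
theorem digit_setDigit_self {A v w : ℕ} (hw : w < 64) (hA : digit A v = 0) :
    digit (setDigit A v w) v = w := by
  apply Nat.eq_of_testBit_eq
  intro i
  have h0 : (digit A v).testBit i = false := by rw [hA, Nat.zero_testBit]
  rw [testBit_digit] at h0 ⊢
  by_cases hi : i < 6
  · simp only [hi, decide_true, Bool.true_and] at h0 ⊢
    rw [testBit_setDigit, h0]
    simp
  · have : w.testBit i = false :=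
      Nat.testBit_lt_two_pow (hw.trans_le (Nat.pow_le_pow_right (n := 2) (i := 6) (by simp) (by omega)))
    simp [hi, this]

theorem digit_setDigit_of_ne {A u v w : ℕ} (hw : w < 64) (huv : u ≠ v) :
    digit (setDigit A v w) u = digit A u := by
  apply Nat.eq_of_testBit_eq
  intro i
  rw [testBit_digit, testBit_digit, testBit_setDigit]
  by_cases hi : i < 6
  · by_cases h : 6 * v ≤ 6 * u + i
    · have : w.testBit (6 * u + i - 6 * v) = false :=
        Nat.testBit_lt_two_pow
          (hw.trans_le (Nat.pow_le_pow_right (n := 2) (i := 6) (by simp) (by omega)))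
      simp [this]
    · simp [h]
  · simp [hi]

/-- The block number `v` of the table `T`. -/
def tableRow (T v : ℕ) : ℕ := Nat.shiftRight T (Nat.mul 64 v)

/-- Is `w` one of the digits of `r` at the places in `is`? -/
def hasDigit (r : ℕ) (is : List ℕ) (w : ℕ) : Bool := is.any fun j => Nat.beq (digit r j) w

/-- A plan is a list of triples `(v, u, us)`: the vertices `v` are treated in this order, and
`u` and the members of `us` are the neighbours of `v` which have been treated before. -/
def extendAll (T : ℕ) (is : List ℕ) (leaf : ℕ → Bool) :
    List (ℕ × ℕ × List ℕ) → ℕ → ℕ → Bool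
  | [], A, _ => leaf A
  | (v, u, us) :: P, A, U =>
    is.all fun j => withValue (digit (tableRow T (digit A u)) j) fun w =>
      bif hasBit U w then true else
      bif us.all (fun y => hasDigit (tableRow T (digit A y)) is w) then
        withValue (setDigit A v w) fun A' => withValue (Nat.lor U (Nat.shiftLeft 1 w)) fun U' =>
          extendAll T is leaf P A' U'
      else true

/-- The plan with the given order of vertices, cut off at the first vertex without a neighbour
which has been treated before. -/
def makePlan (nb : ℕ → List ℕ) : List ℕ → List ℕ → List (ℕ × ℕ × List ℕ)
  | _, [] => []
  | don, v :: vs =>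
    match (nb v).filter (fun u => don.elem u) with
    | [] => []
    | u :: us => if v ∈ don then [] else (v, u, us) :: makePlan nb (v :: don) vs

/-- The invariant behind both uses of a plan: freshness of `v` makes its digit writable, and the
earlier neighbours constrain its image and join it to the start. -/
def IsPlan (nb : ℕ → List ℕ) : List ℕ → List (ℕ × ℕ × List ℕ) → Prop
  | _, [] => True
  | don, (v, u, us) :: P =>
    v ∉ don ∧ (∀ y ∈ u :: us, y ∈ nb v ∧ y ∈ don) ∧ IsPlan nb (v :: don) P

theorem isPlan_makePlan (nb : ℕ → List ℕ) (vs don : List ℕ) : IsPlan nb don (makePlan nb don vs) := by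
  induction vs generalizing don with
  | nil => trivial
  | cons v vs ih =>
    rw [makePlan]
    split
    · trivial
    · rename_i u us h
      split_ifs with hv
      · trivial
      · refine ⟨hv, fun y hy => ?_, ih _⟩
        rw [← h] at hy
        simpa using hy

theorem mem_of_mem_makePlan (nb : ℕ → List ℕ) (vs don : List ℕ) {p : ℕ × ℕ × List ℕ}
    (hp : p ∈ makePlan nb don vs) : p.1 ∈ vs := by
  induction vs generalizing don with
  | nil => simp [makePlan] at hp
  | cons v vs ih =>
    rw [makePlan] at hp
    split at hp
    · simp at hp
    · split_ifs at hp
      · simp at hp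
      · rcases List.mem_cons.1 hp with rfl | hp
        · simp
        · exact List.mem_cons_of_mem _ (ih _ hp)

theorem IsPlan.reachable {V : Type*} {Γ : SimpleGraph V} {D : ℕ → V} {nb : ℕ → List ℕ} {N : ℕ}
    (hadj : ∀ v < N, ∀ u ∈ nb v, Γ.Adj (D v) (D u)) {x : V} {P : List (ℕ × ℕ × List ℕ)} :
    ∀ {don : List ℕ}, IsPlan nb don P → (∀ p ∈ P, p.1 < N) → (∀ v ∈ don, Γ.Reachable x (D v)) →
      ∀ p ∈ P, Γ.Reachable x (D p.1) := by
  induction P with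
  | nil => simp
  | cons q P ih =>
    obtain ⟨v, u, us⟩ := q
    intro don ⟨_, hu, hP⟩ hN hdon
    have hv : Γ.Reachable x (D v) := by
      obtain ⟨hu1, hu2⟩ := hu u (by simp)
      exact (hdon u hu2).trans (hadj v (hN (v, u, us) (by simp)) u hu1).symm.reachable
    intro p hp
    rcases List.mem_cons.1 hp with rfl | hp
    · exact hv
    · refine ih hP (fun p hp => hN p (by simp [hp])) ?_ p hp
      intro y hy
      rcases List.mem_cons.1 hy with rfl | hy
      · exact hv
      · exact hdon y hy

/-- The map `F` itself singles out a branch of the search: injectivity and preservation of edges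
ensure that this branch is never pruned, and the invariant says that `A` codes `F` restricted to
`don` while `U` is the image of `don`. -/
theorem extendAll_sound {T N : ℕ} {is : List ℕ} {leaf : ℕ → Bool} {nb : ℕ → List ℕ} {F : ℕ → ℕ}
    (hN : N ≤ 64) (hT : ∀ v < N, is.map (digit (tableRow T v)) = nb v)
    (hF : ∀ v < N, F v < N) (hinj : ∀ u < N, ∀ v < N, F u = F v → u = v)
    (hhom : ∀ u < N, ∀ v < N, u ∈ nb v → F v ∈ nb (F u))
    {P : List (ℕ × ℕ × List ℕ)} : ∀ {don : List ℕ} {A U : ℕ}, IsPlan nb don P →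
      (∀ p ∈ P, p.1 < N) → (∀ v ∈ don, v < N) →
      (∀ v, digit A v = if v ∈ don then F v else 0) →
      (∀ x, U.testBit x = true ↔ ∃ u ∈ don, F u = x) →
      extendAll T is leaf P A U = true →
      ∃ A', leaf A' = true ∧ ∀ v, (v ∈ don ∨ ∃ p ∈ P, p.1 = v) → digit A' v = F v := by
  induction P with
  | nil =>
    intro don A U _ _ _ hA _ h
    exact ⟨A, h, fun v hv => by
      have hv : v ∈ don := by simpa using hv
      rw [hA, if_pos hv]⟩
  | cons q P ih =>
    obtain ⟨v, u, us⟩ := q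
    intro don A U ⟨hv, hus, hP⟩ hPN hdon hA hU h
    have hvN : v < N := hPN (v, u, us) (by simp)
    have key : ∀ y ∈ u :: us, F v ∈ is.map (digit (tableRow T (digit A y))) := by
      intro y hy
      obtain ⟨hy1, hy2⟩ := hus y hy
      have hyN := hdon y hy2
      rw [hA y, if_pos hy2, hT _ (hF y hyN)]
      exact hhom y hyN v hvN hy1
    -- The branch to follow is the slot `j` at which `F v` is listed among the neighbours of `F u`.
    obtain ⟨j, hj, hjv⟩ := List.mem_map.1 (key u (by simp))
    rw [extendAll, List.all_eq_true] at h
    specialize h j hj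
    rw [withValue_eq, hjv, hasBit_eq_testBit] at h
    have hUv : U.testBit (F v) = false := by
      rw [← Bool.not_eq_true, hU]
      rintro ⟨y, hy, hyv⟩
      exact hv (hinj y (hdon y hy) v hvN hyv ▸ hy)
    have hall : (us.all fun y => hasDigit (tableRow T (digit A y)) is (F v)) = true := by
      rw [List.all_eq_true]
      intro y hy
      obtain ⟨i, hi, hiv⟩ := List.mem_map.1 (key y (by simp [hy]))
      rw [hasDigit, List.any_eq_true]
      exact ⟨i, hi, Nat.beq_eq ▸ hiv⟩
    rw [hUv, hall, cond_false, cond_true, withValue_eq, withValue_eq] at h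
    have hv64 : F v < 64 := (hF v hvN).trans_le hN
    have hdigit : ∀ y, digit (setDigit A v (F v)) y = if y ∈ v :: don then F y else 0 := by
      intro y
      by_cases hyv : y = v
      · rw [hyv, digit_setDigit_self hv64 (by rw [hA, if_neg hv]), if_pos (by simp)]
      · rw [digit_setDigit_of_ne hv64 hyv, hA]
        simp [hyv]
    have hbit : ∀ x, (Nat.lor U (Nat.shiftLeft 1 (F v))).testBit x = true ↔
        ∃ y ∈ v :: don, F y = x := by
      intro x
      have e : Nat.lor U (Nat.shiftLeft 1 (F v)) = U ||| (1 <<< F v) := rfl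
      rw [e, Nat.testBit_or, Nat.one_shiftLeft, Nat.testBit_two_pow, Bool.or_eq_true, hU,
        decide_eq_true_iff]
      simp [or_comm]
    obtain ⟨A', hA', hA''⟩ := ih hP (fun p hp => hPN p (by simp [hp]))
      (by simpa using ⟨hvN, hdon⟩) hdigit hbit h
    refine ⟨A', hA', fun y hy => hA'' y ?_⟩
    simpa [or_assoc, eq_comm, or_left_comm] using hy

/-! ### Coded groups and coded bi-Cayley graphs -/

/-- `d` enumerates the group `H` by `0, …, n - 1`, the multiplication being `mul`. -/
structure IsGroupCode {H : Type*} [Group H] (n : ℕ) (mul : ℕ → ℕ → ℕ) (d : ℕ → H) : Prop where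
  inj : ∀ i < n, ∀ j < n, d i = d j → i = j
  surj : ∀ h, ∃ i < n, d i = h
  mul_lt : ∀ i < n, ∀ j < n, mul i j < n
  map_mul : ∀ i < n, ∀ j < n, d (mul i j) = d i * d j

/-- A bi-Cayley graph over a coded group of order `order`, with generators `gens` of the group
and an order `walk` in which the vertices other than `0` are treated by the search.
The vertex `h₀` has the code of `h`, and `h₁` has this number plus `order`. -/
structure BiCayCode where
  order : ℕ
  mul : ℕ → ℕ → ℕ
  right : List ℕ
  left : List ℕ
  spokes : List ℕ
  spokesInv : List ℕ
  gens : List ℕ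
  walk : List ℕ

namespace BiCayCode

/-- Connection elements multiply on the left, since adjacency is a condition on `g h⁻¹`. A spoke
traversed from the second copy to the first needs the inverse element, whence the separate list
`spokesInv`. -/
def nbrs (C : BiCayCode) (v : ℕ) : List ℕ :=
  if v < C.order then
    C.right.map (fun s => C.mul s v) ++ C.spokes.map (fun s => C.mul s v + C.order)
  else
    C.left.map (fun s => C.mul s (v - C.order) + C.order) ++
      C.spokesInv.map (fun s => C.mul s (v - C.order))

/-- The action of `BR(g)`. -/
def act (C : BiCayCode) (v g : ℕ) : ℕ :=
  bif Nat.blt v C.order then C.mul v g else Nat.add (C.mul (Nat.sub v C.order) g) C.order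

/-- Row `v` occupies the bits from `64 v` on, six bits per neighbour. Nothing is proved about this
packing: `Valid` checks that the rows read back correctly. -/
def table (C : BiCayCode) : ℕ :=
  ((List.range (2 * C.order)).map C.nbrs).foldr (fun l A => Nat.add (Nat.mul A (2 ^ 64))
    (l.foldr (fun x B => Nat.add (Nat.mul B 64) x) 0)) 0

def plan (C : BiCayCode) : List (ℕ × ℕ × List ℕ) := makePlan C.nbrs [0] C.walk

/-- Does the permutation `A` normalize `BR`? It is assumed to fix or to interchange the vertices
with numbers `0` and `order`. -/
def normalizes (C : BiCayCode) (A : ℕ) : Bool :=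
  C.gens.all fun g => withValue (Nat.mod (digit A g) C.order) fun k =>
    (List.range (2 * C.order)).all fun v =>
      Nat.beq (digit A (C.act v g)) (C.act (digit A v) k)

def slots (C : BiCayCode) : List ℕ := List.range (C.right.length + C.spokes.length)

/-- All checks on the data, including the search through all automorphisms which fix the first
vertex or move it to the other orbit. -/
def Valid (C : BiCayCode) : Prop :=
  (0 < C.order ∧ C.order ≤ 32 ∧ C.mul 0 0 = 0) ∧
  (∀ s ∈ C.right, s < C.order ∧ s ≠ 0 ∧ ∃ t ∈ C.right, C.mul s t = 0) ∧
  (∀ s ∈ C.left, s < C.order ∧ s ≠ 0 ∧ ∃ t ∈ C.left, C.mul s t = 0) ∧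
  (∀ s ∈ C.spokes, s < C.order ∧ ∃ t ∈ C.spokesInv, C.mul s t = 0) ∧
  (∀ t ∈ C.spokesInv, t < C.order ∧ ∃ s ∈ C.spokes, C.mul s t = 0) ∧
  (∀ g ∈ C.gens, g < C.order) ∧
  -- Each nonzero code is a smaller code times a generator, which lets strong induction pass from
  -- generators to the whole group.
  (∀ i < C.order, i = 0 ∨ ∃ g ∈ C.gens, ∃ j < i, C.mul j g = i) ∧
  (∀ v < 2 * C.order, C.slots.map (digit (tableRow C.table v)) = C.nbrs v) ∧
  (∀ v ∈ C.walk, v < 2 * C.order) ∧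
  -- This rules out that `makePlan` was cut short: leaves are then total maps, and all vertices are
  -- reachable from the vertex `0`.
  (∀ v < 2 * C.order, v = 0 ∨ ∃ p ∈ C.plan, p.1 = v) ∧
  extendAll C.table C.slots C.normalizes C.plan 0 1 = true ∧
  extendAll C.table C.slots C.normalizes C.plan C.order (2 ^ C.order) = true

instance (C : BiCayCode) : Decidable C.Valid := by
  unfold Valid
  infer_instance

section
variable {H : Type*} [Group H]

def rightSet (C : BiCayCode) (d : ℕ → H) : Set H := d '' {s | s ∈ C.right}
def leftSet (C : BiCayCode) (d : ℕ → H) : Set H := d '' {s | s ∈ C.left}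
def spokeSet (C : BiCayCode) (d : ℕ → H) : Set H := d '' {s | s ∈ C.spokes}

/-- The vertex with number `v`. -/
def vertex (C : BiCayCode) (d : ℕ → H) (v : ℕ) : H ⊕ H :=
  if v < C.order then .inl (d v) else .inr (d (v - C.order))

end
end BiCayCode

/-! ### Adjacency in bi-Cayley graphs and the reduction by `BR(H)` -/

section
variable {H : Type*} [Group H] {R L S : Set H}

theorem IsBiCayTriple.adj_inl_inl (h : IsBiCayTriple R L S) (x y : H) :
    (biCayGraph R L S).Adj (.inl x) (.inl y) ↔ y * x⁻¹ ∈ R := by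
  simp only [biCayGraph, SimpleGraph.fromRel_adj, biCayRel, ne_eq, Sum.inl.injEq]
  constructor
  · rintro ⟨-, h1 | h1⟩
    · exact h1
    · simpa using h.inv_right _ h1
  · intro h1
    refine ⟨?_, .inl h1⟩
    rintro rfl
    exact h.one_notMem (.inl (by simpa using h1))

theorem IsBiCayTriple.adj_inr_inr (h : IsBiCayTriple R L S) (x y : H) :
    (biCayGraph R L S).Adj (.inr x) (.inr y) ↔ y * x⁻¹ ∈ L := by
  simp only [biCayGraph, SimpleGraph.fromRel_adj, biCayRel, ne_eq, Sum.inr.injEq]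
  constructor
  · rintro ⟨-, h1 | h1⟩
    · exact h1
    · simpa using h.inv_left _ h1
  · intro h1
    refine ⟨?_, .inl h1⟩
    rintro rfl
    exact h.one_notMem (.inr (by simpa using h1))

theorem biCayGraph_adj_inl_inr (x y : H) :
    (biCayGraph R L S).Adj (.inl x) (.inr y) ↔ y * x⁻¹ ∈ S := by
  simp [biCayGraph, biCayRel]

theorem biCayGraph_adj_inr_inl (x y : H) :
    (biCayGraph R L S).Adj (.inr x) (.inl y) ↔ x * y⁻¹ ∈ S := by
  simp [biCayGraph, biCayRel]

theorem biCayBRIso_mul_apply (a b : H) (x : H ⊕ H) :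
    biCayBRIso R L S (a * b) x = biCayBRIso R L S b (biCayBRIso R L S a x) := by
  rcases x with x | x <;> simp [biCayBRIso, mul_assoc]

theorem biCayBRIso_one_apply (x : H ⊕ H) : biCayBRIso R L S 1 x = x := by
  rcases x with x | x <;> simp [biCayBRIso]

/-- It suffices to consider the automorphisms which fix `1₀` or move it to `1₁`. -/
theorem biCayBR_normal_of_forall
    (h : ∀ φ : biCayGraph R L S ≃g biCayGraph R L S, (φ (.inl 1) = .inl 1 ∨ φ (.inl 1) = .inr 1) →
      ∀ g : H, ∃ k : H, ∀ x, φ (biCayBRIso R L S g x) = biCayBRIso R L S k (φ x)) :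
    (biCayBR R L S).Normal := by
  have hmem : ∀ ψ ∈ biCayBR R L S, ∃ g, ψ = biCayBRIso R L S g := by
    rintro ψ ⟨g, hg⟩
    refine ⟨g, RelIso.ext ?_⟩
    rintro (x | x)
    · exact (hg x).1
    · exact (hg x).2
  have hconj : ∀ φ : biCayGraph R L S ≃g biCayGraph R L S,
      (φ (.inl 1) = .inl 1 ∨ φ (.inl 1) = .inr 1) →
      ∀ ψ ∈ biCayBR R L S, φ * ψ * φ⁻¹ ∈ biCayBR R L S := by
    intro φ hφ ψ hψ
    obtain ⟨g, rfl⟩ := hmem ψ hψ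
    obtain ⟨k, hk⟩ := h φ hφ g
    have : φ * biCayBRIso R L S g * φ⁻¹ = biCayBRIso R L S k := by
      rw [mul_inv_eq_iff_eq_mul]
      exact RelIso.ext hk
    rw [this]
    exact biCayBRIso_mem R L S k
  refine ⟨fun ψ hψ φ => ?_⟩
  -- If `φ` sends `1₀` to a copy of `x`, then `BR(x⁻¹)` brings that vertex back to the identity of
  -- the same copy. The correcting factor lies in `BR(H)` and is conjugated away at the end.
  obtain ⟨g, hg⟩ : ∃ g, (biCayBRIso R L S g * φ) (.inl 1) = .inl 1 ∨
      (biCayBRIso R L S g * φ) (.inl 1) = .inr 1 := by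
    rcases hx : φ (.inl 1) with x | x
    · exact ⟨x⁻¹, .inl (by simp [RelIso.mul_apply, hx, biCayBRIso])⟩
    · exact ⟨x⁻¹, .inr (by simp [RelIso.mul_apply, hx, biCayBRIso])⟩
  have h1 := hconj _ hg ψ hψ
  have hB := biCayBRIso_mem R L S g
  have h2 := Subgroup.mul_mem _ (Subgroup.mul_mem _ (Subgroup.inv_mem _ hB) h1) hB
  simpa [mul_assoc] using h2

end

/-! ### From a valid code to connectedness and normality -/

namespace BiCayCode
variable {H : Type*} [Group H] {C : BiCayCode} {d : ℕ → H}

theorem Valid.map_zero (hC : C.Valid) (hd : IsGroupCode C.order C.mul d) : d 0 = 1 := by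
  obtain ⟨⟨hn, -, h0⟩, -⟩ := hC
  have := hd.map_mul 0 hn 0 hn
  rw [h0] at this
  simpa using this

theorem Valid.isBiCayTriple (hC : C.Valid) (hd : IsGroupCode C.order C.mul d) :
    IsBiCayTriple (C.rightSet d) (C.leftSet d) (C.spokeSet d) := by
  have h1 := hC.map_zero hd
  obtain ⟨⟨hn, -, -⟩, hR, hL, -⟩ := hC
  refine ⟨?_, ?_, ?_⟩
  · rintro _ ⟨s, hs, rfl⟩
    obtain ⟨hsn, -, t, ht, hst⟩ := hR s hs
    refine ⟨t, ht, ?_⟩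
    rw [eq_inv_iff_mul_eq_one, mul_eq_one_iff_eq_inv, eq_comm, inv_eq_iff_mul_eq_one,
      ← hd.map_mul s hsn t (hR t ht).1, hst, h1]
  · rintro _ ⟨s, hs, rfl⟩
    obtain ⟨hsn, -, t, ht, hst⟩ := hL s hs
    refine ⟨t, ht, ?_⟩
    rw [eq_inv_iff_mul_eq_one, mul_eq_one_iff_eq_inv, eq_comm, inv_eq_iff_mul_eq_one,
      ← hd.map_mul s hsn t (hL t ht).1, hst, h1]
  · rintro (⟨s, hs, hs1⟩ | ⟨s, hs, hs1⟩)
    · obtain ⟨hsn, hs0, -⟩ := hR s hs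
      exact hs0 (hd.inj s hsn 0 hn (hs1.trans h1.symm))
    · obtain ⟨hsn, hs0, -⟩ := hL s hs
      exact hs0 (hd.inj s hsn 0 hn (hs1.trans h1.symm))

theorem vertex_inj (hd : IsGroupCode C.order C.mul d) {u v : ℕ} (hu : u < 2 * C.order)
    (hv : v < 2 * C.order) (h : C.vertex d u = C.vertex d v) : u = v := by
  unfold vertex at h
  split_ifs at h with h1 h2 h2
  · exact hd.inj u h1 v h2 (Sum.inl.inj h)
  · have := hd.inj (u - C.order) (by omega) (v - C.order) (by omega) (Sum.inr.inj h)
    omega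

theorem vertex_surj (hd : IsGroupCode C.order C.mul d) (x : H ⊕ H) :
    ∃ v < 2 * C.order, C.vertex d v = x := by
  rcases x with x | x
  · obtain ⟨i, hi, rfl⟩ := hd.surj x
    exact ⟨i, by omega, by simp [vertex, hi]⟩
  · obtain ⟨i, hi, rfl⟩ := hd.surj x
    exact ⟨i + C.order, by omega, by simp [vertex]⟩

theorem vertex_act (hd : IsGroupCode C.order C.mul d) (R L S : Set H) {v g : ℕ}
    (hv : v < 2 * C.order) (hg : g < C.order) :
    C.act v g < 2 * C.order ∧ C.vertex d (C.act v g) = biCayBRIso R L S (d g) (C.vertex d v) := by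
  have hact : C.act v g = if v < C.order then C.mul v g else C.mul (v - C.order) g + C.order := by
    unfold act
    by_cases h : v < C.order
    · have : Nat.blt v C.order = true := by simpa using h
      rw [this, if_pos h, cond_true]
    · have : Nat.blt v C.order = false := by
        rw [← Bool.not_eq_true]
        simpa using h
      rw [this, if_neg h, cond_false]
      rfl
  rw [hact]
  by_cases h : v < C.order
  · have h1 := hd.mul_lt v h g hg
    rw [if_pos h]
    refine ⟨by omega, ?_⟩
    simp [vertex, h, h1, hd.map_mul v h g hg, biCayBRIso]
  · have hv' : v - C.order < C.order := by omega
    have h1 := hd.mul_lt _ hv' g hg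
    rw [if_neg h]
    refine ⟨by omega, ?_⟩
    simp [vertex, h, hd.map_mul _ hv' g hg, biCayBRIso]

theorem mem_map_mul_iff (hd : IsGroupCode C.order C.mul d) {l : List ℕ} (hl : ∀ s ∈ l, s < C.order)
    {i j : ℕ} (hi : i < C.order) (hj : j < C.order) :
    i ∈ l.map (fun s => C.mul s j) ↔ d i * (d j)⁻¹ ∈ d '' {s | s ∈ l} := by
  simp only [List.mem_map, Set.mem_image, Set.mem_ofPred_eq]
  refine exists_congr fun s => and_congr_right fun hs => ?_
  rw [eq_mul_inv_iff_mul_eq, ← hd.map_mul s (hl s hs) j hj]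
  exact ⟨fun h => by rw [h], fun h => hd.inj _ (hd.mul_lt s (hl s hs) j hj) i hi h⟩

theorem mem_map_mul_add (l : List ℕ) (f : ℕ → ℕ) (n i : ℕ) :
    i ∈ l.map (fun s => f s + n) ↔ n ≤ i ∧ i - n ∈ l.map f := by
  simp only [List.mem_map]
  constructor
  · rintro ⟨s, hs, rfl⟩
    exact ⟨by omega, s, hs, by omega⟩
  · rintro ⟨h, s, hs, h2⟩
    exact ⟨s, hs, by omega⟩

theorem Valid.nbrs_lt (hC : C.Valid) (hd : IsGroupCode C.order C.mul d) {u v : ℕ}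
    (hu : u < 2 * C.order) (h : v ∈ C.nbrs u) : v < 2 * C.order := by
  obtain ⟨-, hR, hL, hS, hT, -⟩ := hC
  unfold nbrs at h
  split_ifs at h with hu1
  · rcases List.mem_append.1 h with h | h <;> obtain ⟨s, hs, rfl⟩ := List.mem_map.1 h
    · have := hd.mul_lt s (hR s hs).1 u hu1
      omega
    · have := hd.mul_lt s (hS s hs).1 u hu1
      omega
  · have hu2 : u - C.order < C.order := by omega
    rcases List.mem_append.1 h with h | h <;> obtain ⟨s, hs, rfl⟩ := List.mem_map.1 h
    · have := hd.mul_lt s (hL s hs).1 _ hu2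
      omega
    · have := hd.mul_lt s (hT s hs).1 _ hu2
      omega

theorem Valid.image_spokesInv (hC : C.Valid) (hd : IsGroupCode C.order C.mul d) (x : H) :
    x ∈ d '' {s | s ∈ C.spokesInv} ↔ x⁻¹ ∈ C.spokeSet d := by
  have h1 := hC.map_zero hd
  obtain ⟨-, -, -, hS, hT, -⟩ := hC
  constructor
  · rintro ⟨t, ht, rfl⟩
    obtain ⟨htn, s, hs, hst⟩ := hT t ht
    refine ⟨s, hs, ?_⟩
    rw [eq_inv_iff_mul_eq_one, ← hd.map_mul s (hS s hs).1 t htn, hst, h1]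
  · rintro ⟨s, hs, hx⟩
    obtain ⟨hsn, t, ht, hst⟩ := hS s hs
    refine ⟨t, ht, ?_⟩
    rw [← inv_inj, ← hx, inv_eq_iff_mul_eq_one, mul_eq_one_iff_eq_inv, eq_comm,
      inv_eq_iff_mul_eq_one, ← hd.map_mul s hsn t (hT t ht).1, hst, h1]

theorem Valid.mem_nbrs_iff (hC : C.Valid) (hd : IsGroupCode C.order C.mul d) {u v : ℕ}
    (hu : u < 2 * C.order) (hv : v < 2 * C.order) :
    v ∈ C.nbrs u ↔ (biCayGraph (C.rightSet d) (C.leftSet d) (C.spokeSet d)).Adj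
      (C.vertex d u) (C.vertex d v) := by
  have htri := hC.isBiCayTriple hd
  have hinv := hC.image_spokesInv hd
  obtain ⟨-, hR, hL, hS, hT, -⟩ := hC
  have lt_of_mem : ∀ {l : List ℕ} {i j : ℕ}, (∀ s ∈ l, s < C.order) → j < C.order →
      i ∈ l.map (fun s => C.mul s j) → i < C.order := by
    intro l i j hl hj hi
    obtain ⟨s, hs, rfl⟩ := List.mem_map.1 hi
    exact hd.mul_lt s (hl s hs) j hj
  unfold nbrs vertex
  by_cases hu1 : u < C.order <;> by_cases hv1 : v < C.order
  · have : v ∉ C.spokes.map (fun s => C.mul s u + C.order) := by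
      rw [mem_map_mul_add]
      omega
    rw [if_pos hu1, if_pos hu1, if_pos hv1, List.mem_append, or_iff_left this,
      htri.adj_inl_inl, mem_map_mul_iff hd (fun s hs => (hR s hs).1) hv1 hu1]
    rfl
  · have : v ∉ C.right.map (fun s => C.mul s u) :=
      fun h => hv1 (lt_of_mem (fun s hs => (hR s hs).1) hu1 h)
    rw [if_pos hu1, if_pos hu1, if_neg hv1, List.mem_append, or_iff_right this,
      mem_map_mul_add, biCayGraph_adj_inl_inr,
      mem_map_mul_iff hd (fun s hs => (hS s hs).1) (by omega) hu1, and_iff_right (by omega)]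
    rfl
  · have : v ∉ C.left.map (fun s => C.mul s (u - C.order) + C.order) := by
      rw [mem_map_mul_add]
      omega
    rw [if_neg hu1, if_neg hu1, if_pos hv1, List.mem_append, or_iff_right this,
      biCayGraph_adj_inr_inl, mem_map_mul_iff hd (fun s hs => (hT s hs).1) hv1 (by omega), hinv,
      mul_inv_rev, inv_inv]
  · have : v ∉ C.spokesInv.map (fun s => C.mul s (u - C.order)) :=
      fun h => hv1 (lt_of_mem (fun s hs => (hT s hs).1) (by omega) h)
    rw [if_neg hu1, if_neg hu1, if_neg hv1, List.mem_append, or_iff_left this,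
      mem_map_mul_add, htri.adj_inr_inr,
      mem_map_mul_iff hd (fun s hs => (hL s hs).1) (by omega) (by omega), and_iff_right (by omega)]
    rfl

theorem Valid.connected (hC : C.Valid) (hd : IsGroupCode C.order C.mul d) :
    (biCayGraph (C.rightSet d) (C.leftSet d) (C.spokeSet d)).Connected := by
  have hadj {u v : ℕ} := hC.mem_nbrs_iff hd (u := u) (v := v)
  have hlt {u v : ℕ} := hC.nbrs_lt hd (u := u) (v := v)
  obtain ⟨⟨hn, -⟩, -, -, -, -, -, -, -, hwalk, hplan, -⟩ := hC
  have hreach : ∀ p ∈ C.plan, (biCayGraph (C.rightSet d) (C.leftSet d) (C.spokeSet d)).Reachable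
      (C.vertex d 0) (C.vertex d p.1) :=
    (isPlan_makePlan C.nbrs C.walk [0]).reachable (N := 2 * C.order)
      (fun v hv u hu => (hadj hv (hlt hv hu)).1 hu)
      (fun p hp => hwalk _ (mem_of_mem_makePlan _ _ _ hp)) (by simp)
  rw [SimpleGraph.connected_iff_exists_forall_reachable]
  refine ⟨C.vertex d 0, fun x => ?_⟩
  obtain ⟨v, hv, rfl⟩ := vertex_surj hd x
  rcases hplan v hv with rfl | ⟨p, hp, rfl⟩
  · exact SimpleGraph.Reachable.refl _
  · exact hreach p hp

theorem Valid.normal (hC : C.Valid) (hd : IsGroupCode C.order C.mul d) :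
    (biCayBR (C.rightSet d) (C.leftSet d) (C.spokeSet d)).Normal := by
  have hadj {u v : ℕ} := hC.mem_nbrs_iff hd (u := u) (v := v)
  have h1 := hC.map_zero hd
  obtain ⟨⟨hn, hn32, -⟩, -, -, -, -, hgens, hgen, htable, hwalk, hplan, hs0, hs1⟩ := hC
  have hv0 : C.vertex d 0 = .inl 1 := by rw [vertex, if_pos hn, h1]
  have hvn : C.vertex d C.order = .inr 1 := by
    rw [vertex, if_neg (lt_irrefl _), Nat.sub_self, h1]
  apply biCayBR_normal_of_forall
  intro φ hφ
  -- The automorphism `φ` is carried over to a map `F` of vertex numbers, the form in which the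
  -- search sees it.
  choose enc henc hdec using vertex_surj (C := C) hd
  set F : ℕ → ℕ := fun v => enc (φ (C.vertex d v)) with hF
  have hFv : ∀ v, C.vertex d (F v) = φ (C.vertex d v) := fun v => hdec _
  have hFlt : ∀ v, F v < 2 * C.order := fun v => henc _
  have hFinj : ∀ u < 2 * C.order, ∀ v < 2 * C.order, F u = F v → u = v := by
    intro u hu v hv h
    apply vertex_inj hd hu hv
    apply φ.injective
    rw [← hFv, ← hFv, h]
  have hFhom : ∀ u < 2 * C.order, ∀ v < 2 * C.order, u ∈ C.nbrs v → F v ∈ C.nbrs (F u) := by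
    intro u hu v hv h
    rw [hadj (hFlt u) (hFlt v), hFv, hFv, SimpleGraph.Iso.map_adj_iff]
    exact ((hadj hv hu).1 h).symm
  have hsound : ∀ a, F 0 = a →
      extendAll C.table C.slots C.normalizes C.plan a (2 ^ a) = true →
      ∃ A, C.normalizes A = true ∧ ∀ v < 2 * C.order, digit A v = F v := by
    rintro a ha h
    have ha64 : a < 64 := by
      have := hFlt 0
      omega
    obtain ⟨A, hA, hAF⟩ := extendAll_sound (N := 2 * C.order) (by omega) htable
      (fun v _ => hFlt v) hFinj hFhom (isPlan_makePlan C.nbrs C.walk [0])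
      (fun p hp => hwalk _ (mem_of_mem_makePlan _ _ _ hp)) (don := [0]) (by simpa using hn)
      (A := a) (U := 2 ^ a) (fun v => by
        -- The number `a` is its own digit at place `0`, so it codes the partial map `0 ↦ a`;
        -- accordingly `2 ^ a` is the used set `{a}`.
        have hset : a = setDigit 0 0 a := by
          have e : setDigit 0 0 a = 0 ||| a <<< 0 := rfl
          simp [e]
        have hzero : ∀ v, digit 0 v = 0 := fun v => by
          have e : digit 0 v = (0 >>> (6 * v)) % 64 := rfl
          simp [e]
        by_cases hv : v = 0
        · rw [hv, hset, digit_setDigit_self ha64 (hzero 0), if_pos (by simp), ha]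
        · rw [hset, digit_setDigit_of_ne ha64 hv, hzero, if_neg (by simpa using hv)])
      (fun x => by rw [Nat.testBit_two_pow]; simp [ha]) h
    refine ⟨A, hA, fun v hv => hAF v ?_⟩
    rcases hplan v hv with rfl | hp
    · simp
    · exact .inr hp
  obtain ⟨A, hA, hAF⟩ : ∃ A, C.normalizes A = true ∧ ∀ v < 2 * C.order, digit A v = F v := by
    rcases hφ with hφ | hφ
    · refine hsound 0 ?_ hs0
      exact vertex_inj hd (hFlt 0) (by omega) (by rw [hFv, hv0, hφ])
    · refine hsound C.order ?_ hs1
      exact vertex_inj hd (hFlt 0) (by omega) (by rw [hFv, hv0, hφ, hvn])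
  have hgenk : ∀ g ∈ C.gens, ∃ k : H, ∀ x, φ (biCayBRIso (C.rightSet d) (C.leftSet d) (C.spokeSet d) (d g) x) =
      biCayBRIso (C.rightSet d) (C.leftSet d) (C.spokeSet d) k (φ x) := by
    intro g hg
    have hgn := hgens g hg
    rw [normalizes, List.all_eq_true] at hA
    have hA := hA g hg
    rw [withValue_eq, List.all_eq_true] at hA
    have hk : Nat.mod (digit A g) C.order < C.order := Nat.mod_lt _ hn
    -- If `φ BR(g) φ⁻¹ = BR(k)`, evaluation at `φ(1₀)`, which is `1₀` or `1₁`, shows that `φ(g₀)` is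
    -- `k₀` or `k₁`. So `k` can only be the image of `g₀` with the copy forgotten, which is what
    -- reduction modulo the order does.
    refine ⟨d (Nat.mod (digit A g) C.order), fun x => ?_⟩
    obtain ⟨v, hv, rfl⟩ := vertex_surj (C := C) hd x
    have hAv := Nat.beq_eq ▸ hA v (List.mem_range.2 hv)
    obtain ⟨h2, h3⟩ := vertex_act hd (C.rightSet d) (C.leftSet d) (C.spokeSet d) hv hgn
    obtain ⟨h4, h5⟩ := vertex_act hd (C.rightSet d) (C.leftSet d) (C.spokeSet d) (hFlt v) hk
    rw [hAF v hv, hAF _ h2] at hAv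
    rw [← h3, ← hFv, ← hFv, hAv, h5]
  intro g
  obtain ⟨i, hi, rfl⟩ := hd.surj g
  induction i using Nat.strong_induction_on with
  | _ i ih =>
    rcases hgen i hi with rfl | ⟨g, hg, j, hj, rfl⟩
    · refine ⟨1, fun x => ?_⟩
      rw [h1, biCayBRIso_one_apply, biCayBRIso_one_apply]
    · obtain ⟨k, hk⟩ := ih j hj (by omega)
      obtain ⟨l, hl⟩ := hgenk g hg
      refine ⟨k * l, fun x => ?_⟩
      rw [hd.map_mul j (by omega) g (hgens g hg), biCayBRIso_mul_apply, biCayBRIso_mul_apply,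
        hl, hk]

end BiCayCode

/-! ### Recognizing connected normal bi-Cayley graphs -/

theorem surj_of_card {V : Type*} {n : ℕ} (hn : 0 < n) (hcard : Nat.card V = n) {d : ℕ → V}
    (hinj : ∀ i < n, ∀ j < n, d i = d j → i = j) (x : V) : ∃ i < n, d i = x := by
  have : Finite V := Nat.finite_of_card_ne_zero (by omega)
  have hb : Function.Bijective (fun i : Fin n => d i) :=
    (Nat.bijective_iff_injective_and_card _).2
      ⟨fun i j h => Fin.ext (hinj i i.2 j j.2 h), by simp [hcard]⟩
  obtain ⟨i, hi⟩ := hb.2 x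
  exact ⟨i, i.2, hi⟩

theorem IsGroupCode.of_card {H : Type*} [Group H] {n : ℕ} {mul : ℕ → ℕ → ℕ} {d : ℕ → H}
    (hn : 0 < n) (hcard : Nat.card H = n) (hinj : ∀ i < n, ∀ j < n, d i = d j → i = j)
    (hmul : ∀ i < n, ∀ j < n, mul i j < n ∧ d (mul i j) = d i * d j) : IsGroupCode n mul d where
  inj := hinj
  surj := surj_of_card hn hcard hinj
  mul_lt i hi j hj := (hmul i hi j hj).1
  map_mul i hi j hj := (hmul i hi j hj).2

theorem BiCayCode.Valid.isConnectedNormalBiCayley {H V : Type*} [Group H] {C : BiCayCode}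
    {d : ℕ → H} (hC : C.Valid) (hd : IsGroupCode C.order C.mul d) {Γ : SimpleGraph V}
    (e : Γ ≃g biCayGraph (C.rightSet d) (C.leftSet d) (C.spokeSet d)) :
    IsConnectedNormalBiCayley H Γ :=
  ⟨e.connected_iff.2 (hC.connected hd), _, _, _, hC.isBiCayTriple hd, hC.normal hd, ⟨e⟩⟩

/-- The vertices of `Γ` are numbered by `g` in such a way that the coded graph results. -/
theorem BiCayCode.Valid.isConnectedNormalBiCayley_of_numbering {H V : Type*} [Group H]
    {C : BiCayCode} {d : ℕ → H} (hC : C.Valid) (hd : IsGroupCode C.order C.mul d)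
    {Γ : SimpleGraph V} {g : ℕ → V} (hcard : Nat.card V = 2 * C.order)
    (hinj : ∀ u < 2 * C.order, ∀ v < 2 * C.order, g u = g v → u = v)
    (hadj : ∀ u < 2 * C.order, ∀ v < 2 * C.order, Γ.Adj (g u) (g v) ↔ v ∈ C.nbrs u) :
    IsConnectedNormalBiCayley H Γ := by
  have hg : Function.Bijective (fun i : Fin (2 * C.order) => g i) :=
    ⟨fun i j h => Fin.ext (hinj i i.2 j j.2 h), fun x => by
      obtain ⟨i, hi, h⟩ := surj_of_card (by have := hC.1.1; omega) hcard hinj x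
      exact ⟨⟨i, hi⟩, h⟩⟩
  have hv : Function.Bijective (fun i : Fin (2 * C.order) => C.vertex d i) :=
    ⟨fun i j h => Fin.ext (vertex_inj hd i.2 j.2 h), fun x => by
      obtain ⟨i, hi, h⟩ := vertex_surj hd x
      exact ⟨⟨i, hi⟩, h⟩⟩
  let e₁ := Equiv.ofBijective _ hg
  let e₂ := Equiv.ofBijective _ hv
  refine hC.isConnectedNormalBiCayley hd ⟨e₁.symm.trans e₂, ?_⟩
  intro x y
  obtain ⟨i, rfl⟩ := e₁.surjective x
  obtain ⟨j, rfl⟩ := e₁.surjective y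
  simp only [Equiv.trans_apply, Equiv.symm_apply_apply]
  exact (hC.mem_nbrs_iff hd i.2 j.2).symm.trans (hadj i i.2 j j.2).symm

/-! ### Prisms over Cayley graphs -/

section
variable {H : Type*} [Group H]

theorem IsBiCayTriple.cayGraph_adj {T S : Set H} (hT : IsBiCayTriple T T S) (x y : H) :
    (cayGraph T).Adj x y ↔ y * x⁻¹ ∈ T := by
  rw [← hT.adj_inl_inl]
  simp [cayGraph, biCayGraph, biCayRel]

/-- The prism over `Cay(H, T)` is `BiCay(H, T, T, {1})`. -/
noncomputable def cayGraphPrismIso {T : Set H} (hT : IsBiCayTriple T T {1}) :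
    (cayGraph T □ graphK2 : SimpleGraph (H × Fin 2)) ≃g biCayGraph T T {1} where
  toFun x := if x.2 = 0 then .inl x.1 else .inr x.1
  invFun := Sum.elim (fun h => (h, 0)) (fun h => (h, 1))
  left_inv := by
    rintro ⟨x, i⟩
    fin_cases i <;> simp
  right_inv := by rintro (x | x) <;> simp
  map_rel_iff' := by
    rintro ⟨x, i⟩ ⟨y, j⟩
    fin_cases i <;> fin_cases j <;>
      simp [SimpleGraph.boxProd_adj, hT.cayGraph_adj, hT.adj_inl_inl, hT.adj_inr_inr,
        biCayGraph_adj_inl_inr, biCayGraph_adj_inr_inl, mul_inv_eq_one, eq_comm]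

/-- The code of the prism over the Cayley graph with connection list `T`. The search goes through
`Cay(H, T)` in the order `0 :: walk`, first in one copy and then in the other. -/
def prismCode (n : ℕ) (mul : ℕ → ℕ → ℕ) (T gens walk : List ℕ) : BiCayCode :=
  ⟨n, mul, T, T, [0], [0], gens, walk ++ (0 :: walk).map (· + n)⟩

theorem isConnectedNormalBiCayley_prism {n : ℕ} {mul : ℕ → ℕ → ℕ} {T gens walk : List ℕ}
    {d : ℕ → H} {S : Set H} (hC : (prismCode n mul T gens walk).Valid) (hd : IsGroupCode n mul d)
    (hS : S = d '' {s | s ∈ T}) : IsConnectedNormalBiCayley H (cayGraph S □ graphK2) := by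
  have hspoke : (prismCode n mul T gens walk).spokeSet d = {1} := by
    rw [← hC.map_zero hd]
    simp [BiCayCode.spokeSet, prismCode]
  have htri := hC.isBiCayTriple hd
  rw [hspoke] at htri
  have hS' : S = (prismCode n mul T gens walk).rightSet d := hS
  refine hC.isConnectedNormalBiCayley hd ?_
  rw [hspoke, hS']
  exact cayGraphPrismIso htri

end

/-! ### Transport along group isomorphisms -/

/-- The isomorphism of bi-Cayley graphs given by an isomorphism of groups. -/
def biCayGraphCongr {G H : Type*} [Group G] [Group H] (e : G ≃* H) (R L S : Set H) :
    biCayGraph (e ⁻¹' R) (e ⁻¹' L) (e ⁻¹' S) ≃g biCayGraph R L S where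
  toEquiv := Equiv.sumCongr e.toEquiv e.toEquiv
  map_rel_iff' := by
    rintro (x | x) (y | y) <;> simp [biCayGraph, biCayRel]

/-- Pulling the connection sets back along `e` gives an isomorphic graph, and conjugation by that
graph isomorphism matches the two groups `BR`, so normality is inherited. -/
theorem IsConnectedNormalBiCayley.exists_of_mulEquiv {G H V : Type*} [Group G] [Group H]
    {Γ : SimpleGraph V} (h : IsConnectedNormalBiCayley H Γ) (e : G ≃* H) :
    ∃ R L S : Set G, IsBiCayTriple R L S ∧ (biCayGraph R L S).Connected ∧
      (biCayBR R L S).Normal := by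
  obtain ⟨hconn, R, L, S, htri, hnorm, ⟨i⟩⟩ := h
  let f := biCayGraphCongr e R L S
  refine ⟨e ⁻¹' R, e ⁻¹' L, e ⁻¹' S, ⟨fun x hx => ?_, fun x hx => ?_, ?_⟩,
    f.connected_iff.2 (i.connected_iff.1 hconn), ⟨fun ψ hψ φ => ?_⟩⟩
  · simpa using htri.inv_right _ hx
  · simpa using htri.inv_left _ hx
  · simpa using htri.one_notMem
  · have hmem : ∀ χ, χ ∈ biCayBR (e ⁻¹' R) (e ⁻¹' L) (e ⁻¹' S) ↔
        (f.symm.trans (χ.trans f)) ∈ biCayBR R L S := by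
      intro χ
      have hfl : ∀ x, f (.inl x) = .inl (e x) := fun _ => rfl
      have hfr : ∀ x, f (.inr x) = .inr (e x) := fun _ => rfl
      have hsl : ∀ x, f.symm (.inl (e x)) = .inl x := fun x => by rw [← hfl, f.symm_apply_apply]
      have hsr : ∀ x, f.symm (.inr (e x)) = .inr x := fun x => by rw [← hfr, f.symm_apply_apply]
      constructor
      · rintro ⟨g, hg⟩
        refine ⟨e g, fun x => ?_⟩
        obtain ⟨x, rfl⟩ := e.surjective x
        constructor
        · simp [hsl, (hg x).1, hfl]
        · simp [hsr, (hg x).2, hfr]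
      · rintro ⟨g, hg⟩
        refine ⟨e.symm g, fun x => ?_⟩
        constructor
        · apply f.injective
          simpa [hsl, hfl] using (hg (e x)).1
        · apply f.injective
          simpa [hsr, hfr] using (hg (e x)).2
    rw [hmem] at hψ ⊢
    have := hnorm.conj_mem _ hψ (f.symm.trans (φ.trans f))
    convert this using 1
    rw [eq_mul_inv_iff_mul_eq]
    ext x
    simp [RelIso.mul_apply]

/-! ### The codes of the graphs in question -/

def mulDihedral (n x y : ℕ) : ℕ :=
  if x < n then
    if y < n then (x + y) % n else n + (y % n + n - x) % n
  else
    if y < n then n + (x % n + y) % n else (y % n + n - x % n) % n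

/-- Elements are `v t ^ k`, coded as `v + 4 k`, with `v` in the Klein four-group (addition is xor)
and `t` a 3-cycle. Conjugation by `t` permutes the codes `1, 2, 3` cyclically. -/
def mulAlt4 (x y : ℕ) : ℕ :=
  (x % 4).xor (if y % 4 = 0 then 0 else (y % 4 - 1 + x / 4) % 3 + 1) + 4 * ((x / 4 + y / 4) % 3)

/-- The normal form is `a ^ i * b ^ j * z ^ k` with `z = abc` central of order dividing 4 and `ba =
ab z²`, coded as `i + 2 j + 4 k`. In the last term only the parities of `j` and `i'` matter. -/
def mulE4 (x y : ℕ) : ℕ :=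
  (x + y) % 2 + 2 * ((x / 2 + y / 2) % 2) + 4 * ((x / 4 + y / 4 + 2 * (x / 2 * y)) % 4)

def mulE5 (x y : ℕ) : ℕ := (x + 5 ^ (x / 8) * y) % 8 + 8 * ((x / 8 + y / 8) % 2)

def mulE6 (x y : ℕ) : ℕ :=
  (x + 2 ^ (x / 9) * y) % 3 + 3 * ((x / 3 + 2 ^ (x / 9) * (y / 3)) % 3) +
    9 * ((x / 9 + y / 9) % 2)

def mulE7 (x y : ℕ) : ℕ :=
  (x + y) % 3 + 3 * ((x / 3 + y / 3) % 3) + 9 * ((x / 9 + y / 9 + 2 * (x / 3 * y)) % 3)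

def mulQ8 (x y : ℕ) : ℕ :=
  if x < 4 then
    if y < 4 then (x + y) % 4 else 4 + (y % 4 + 4 - x) % 4
  else
    -- In `6 = 2 + 4`, the `2` comes from `xa i * xa j = a (2 + j - i)` and the `4` avoids truncated
    -- subtraction.
    if y < 4 then 4 + (x % 4 + y) % 4 else (6 + y % 4 - x % 4) % 4

def mulQ8Cyc (n x y : ℕ) : ℕ := mulQ8 (x % 8) (y % 8) + 8 * ((x / 8 + y / 8) % n)

/-- With no edges inside a copy, the two copies are the even and the odd vectors; `BR` acts by
translations with even vectors. A spoke flips the last coordinate (code `0`) or one of the others.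
-/
def codeHypercube (n : ℕ) : BiCayCode where
  order := 2 ^ n
  mul := Nat.xor
  right := []
  left := []
  spokes := 0 :: (List.range n).map (2 ^ ·)
  spokesInv := 0 :: (List.range n).map (2 ^ ·)
  gens := (List.range n).map (2 ^ ·)
  walk := ((List.range (2 ^ n)).flatMap fun i => [i, 2 ^ n + i]).tail

def codeDihedral (n : ℕ) : BiCayCode :=
  prismCode (2 * n) (mulDihedral n) [n, n + 1] [1, n]
    ([n, n + 1] ++ (List.range (n - 2)).flatMap (fun i => [i + 1, n + i + 2]) ++ [n - 1])

def codeAlt4 : BiCayCode :=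
  prismCode 12 mulAlt4 [4, 8, 10, 7] [1, 2, 4] [4, 8, 2, 7, 9, 10, 3, 5, 1, 6, 11]

def codeE4 : BiCayCode :=
  prismCode 16 mulE4 [1, 2, 15] [1, 2, 4] [1, 2, 3, 4, 6, 5, 15, 7, 13, 8, 9, 10, 11, 12, 14]

def codeE5 : BiCayCode :=
  prismCode 16 mulE5 [1, 7, 8, 4, 12] [1, 8] (List.range 16).tail

def codeE6 : BiCayCode :=
  prismCode 18 mulE6 [9, 11, 15, 17] [1, 3, 9]
    [9, 2, 15, 3, 17, 1, 10, 8, 11, 6, 12, 5, 16, 4, 13, 7, 14]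

def codeE7 : BiCayCode :=
  prismCode 27 mulE7 [1, 3, 2, 6] [1, 3, 9] [1, 2, 3, 6, 4, 5, 7, 8, 10, 11, 9, 23, 22, 16, 15,
    17, 12, 13, 14, 19, 20, 18, 21, 24, 25, 26]

/-- The spokes `0, 1, 4` stand for `1`, `a` and `xa 0` in the quaternion group and give `GP(8, 3)`;
the factor `C_n` comes from the generator of `ℤₙ` and its inverse inside each copy. -/
def codeQ8Cyc (n : ℕ) : BiCayCode where
  order := 8 * n
  mul := mulQ8Cyc n
  right := [8, 8 * (n - 1)]
  left := [8, 8 * (n - 1)]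
  spokes := [0, 1, 4]
  spokesInv := [0, 3, 6]
  gens := [1, 4, 8]
  walk :=
    let m := 8 * n
    ([0, m, 3, 6, m + 1, 1, m + 5, 5, m + 3, m + 4, 2, m + 2, 4, m + 6, 7, m + 7].flatMap
      fun v => (List.range n).map (v + 8 * ·)).tail

/-! ### Running the searches -/

theorem valid_codeHypercube {n : ℕ} (hn : n = 2 ∨ n = 3 ∨ n = 4) : (codeHypercube n).Valid := by
  rcases hn with rfl | rfl | rfl <;> decide +kernel

theorem valid_codeDihedral {n : ℕ} (hn : n = 3 ∨ n = 4 ∨ n = 5) : (codeDihedral n).Valid := by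
  rcases hn with rfl | rfl | rfl <;> decide +kernel

theorem valid_codeAlt4 : codeAlt4.Valid := by decide +kernel

theorem valid_codeE4 : codeE4.Valid := by decide +kernel

theorem valid_codeE5 : codeE5.Valid := by decide +kernel

theorem valid_codeE6 : codeE6.Valid := by decide +kernel

theorem valid_codeE7 : codeE7.Valid := by decide +kernel

theorem valid_codeQ8Cyc {n : ℕ} (hn : n = 3 ∨ n = 4) : (codeQ8Cyc n).Valid := by
  rcases hn with rfl | rfl <;> decide +kernel

/-! ### The groups which are not given by presentations -/

def decodeElemAb2 (n i : ℕ) : ElemAb2 n :=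
  Multiplicative.ofAdd fun k => if i.testBit k then 1 else 0

def decodeDihedral (n i : ℕ) : DihedralGroup n :=
  if i < n then .r i else .sr i

def decodeAlt4 (i : ℕ) : alternatingGroup (Fin 4) :=
  ⟨c[0, 1] * c[2, 3], Equiv.Perm.mem_alternatingGroup.2 (by decide)⟩ ^ (i % 2) * ⟨c[0, 3] * c[1, 2], Equiv.Perm.mem_alternatingGroup.2 (by decide)⟩ ^ (i / 2 % 2) *
    ⟨c[0, 1, 2], Equiv.Perm.mem_alternatingGroup.2 (by decide)⟩ ^ (i / 4)

def decodeQ8 (i : ℕ) : QuaternionGroup 2 :=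
  if i < 4 then .a (i : ZMod 4) else .xa (i : ZMod 4)

def decodeQ8Cyc (n i : ℕ) : QuaternionGroup 2 × Cyc n :=
  (decodeQ8 (i % 8), Multiplicative.ofAdd (i / 8 : ℕ))

theorem isGroupCode_elemAb2 {n : ℕ} (hn : n = 2 ∨ n = 3 ∨ n = 4) :
    IsGroupCode (2 ^ n) Nat.xor (decodeElemAb2 n) := by
  have hcard : Nat.card (ElemAb2 n) = 2 ^ n := by simp [Nat.card_eq_fintype_card]
  refine .of_card (by positivity) hcard ?_ ?_ <;> clear hcard <;>
    rcases hn with rfl | rfl | rfl <;> decide +kernel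

theorem isGroupCode_dihedral {n : ℕ} (hn : n = 3 ∨ n = 4 ∨ n = 5) :
    IsGroupCode (2 * n) (mulDihedral n) (decodeDihedral n) := by
  refine .of_card (by omega) DihedralGroup.nat_card ?_ ?_ <;>
    rcases hn with rfl | rfl | rfl <;> decide +kernel

theorem isGroupCode_alt4 : IsGroupCode 12 mulAlt4 decodeAlt4 := by
  refine .of_card (by omega) ?_ ?_ ?_
  · rw [nat_card_alternatingGroup]
    simp
    rfl
  · decide +kernel
  · decide +kernel

theorem isGroupCode_q8Cyc {n : ℕ} (hn : n = 3 ∨ n = 4) :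
    IsGroupCode (8 * n) (mulQ8Cyc n) (decodeQ8Cyc n) := by
  refine .of_card (by omega) ?_ ?_ ?_
  · rw [Nat.card_prod, Nat.card_eq_fintype_card, QuaternionGroup.card,
      Nat.card_congr Multiplicative.toAdd, Nat.card_zmod]
  all_goals rcases hn with rfl | rfl <;> decide +kernel

theorem connA4_eq : connA4 = decodeAlt4 '' {s | s ∈ [4, 8, 10, 7]} := by
  have h : ∀ x, x ∈ connA4 ↔ ∃ s ∈ [4, 8, 10, 7], decodeAlt4 s = x := by
    simp only [connA4, Set.mem_ofPred_eq, Set.mem_insert_iff, Set.mem_singleton_iff]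
    decide +kernel
  ext x
  exact h x

/-! ### Numberings of the vertices -/

instance (n : ℕ) : DecidableRel (hypercube n).Adj := fun x y =>
  inferInstanceAs (Decidable (∃ i, x i ≠ y i ∧ ∀ j, x j ≠ y j → j = i))

instance : DecidableRel graphGP83.Adj
  | .inl i, .inl j => decidable_of_iff (i ≠ j ∧ (j = i + 1 ∨ i = j + 1)) (by simp [graphGP83])
  | .inr i, .inr j => decidable_of_iff (i ≠ j ∧ (j = i + 3 ∨ i = j + 3)) (by simp [graphGP83])
  | .inl i, .inr j => decidable_of_iff (j = i) (by simp [graphGP83])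
  | .inr i, .inl j => decidable_of_iff (i = j) (by simp [graphGP83])

/-- `h₀` and `h₁` correspond to the two vectors with the first `n` coordinates given by `h`; that
of `h₀` has an even number of ones. -/
def numberingHypercube (n u : ℕ) : Fin (n + 1) → Bool := fun k =>
  if k < n then u.testBit k else
    (List.range n).foldr (fun j b => b.xor (u.testBit j)) (decide (2 ^ n ≤ u))

/-- Left multiplication by `sr 0` and `sr 1` takes `r i` to `sr i` and `sr (i + 1)`. So `r i` sits
at `2 i` and `sr i` at `2 i - 1`, which is `2 (n + i) - 1` modulo `2 n`. -/
def numberingCyclePrism (n : ℕ) [NeZero (2 * n)] (u : ℕ) : Fin (2 * n) × Fin 2 :=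
  let h := u % (2 * n)
  (Fin.ofNat _ (if h < n then 2 * h else 2 * h - 1), if u < 2 * n then 0 else 1)

/-- The two halves of the list are the bipartition classes: even outer with odd inner vertices, and
odd outer with even inner ones. -/
def numberingGP83 (u : ℕ) : ZMod 8 ⊕ ZMod 8 :=
  [.inl 0, .inl 6, .inl 4, .inl 2, .inr 5, .inr 3, .inr 1, .inr 7,
   .inl 1, .inl 7, .inl 5, .inl 3, .inr 0, .inr 6, .inr 4, .inr 2].getD u (.inl 0)

def numberingGP83Cycle (n : ℕ) [NeZero n] (u : ℕ) : (ZMod 8 ⊕ ZMod 8) × Fin n :=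
  (numberingGP83 (u % 8 + if u < 8 * n then 0 else 8), Fin.ofNat _ (u / 8))

theorem isConnectedNormalBiCayley_hypercube {n : ℕ} (hn : n = 2 ∨ n = 3 ∨ n = 4) :
    IsConnectedNormalBiCayley (ElemAb2 n) (hypercube (n + 1)) := by
  refine (valid_codeHypercube hn).isConnectedNormalBiCayley_of_numbering
    (isGroupCode_elemAb2 hn) (g := numberingHypercube n) ?_ ?_ ?_
  · simp [Nat.card_eq_fintype_card, codeHypercube, pow_succ, mul_comm]
  all_goals rcases hn with rfl | rfl | rfl <;> decide +kernel

theorem isConnectedNormalBiCayley_cycle_prism {n : ℕ} (hn : n = 3 ∨ n = 4 ∨ n = 5) :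
    IsConnectedNormalBiCayley (DihedralGroup n) (SimpleGraph.cycleGraph (2 * n) □ graphK2) := by
  have hC := valid_codeDihedral hn
  have hd := isGroupCode_dihedral hn
  rcases hn with rfl | rfl | rfl
  all_goals
    refine hC.isConnectedNormalBiCayley_of_numbering hd (g := numberingCyclePrism _) ?_ ?_ ?_
    · simp [codeDihedral, prismCode]
    · decide +kernel
    · simp only [SimpleGraph.boxProd_adj]
      decide +kernel

theorem isConnectedNormalBiCayley_GP83_cycle {n : ℕ} (hn : n = 3 ∨ n = 4) :
    IsConnectedNormalBiCayley (QuaternionGroup 2 × Cyc n)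
      (graphGP83 □ SimpleGraph.cycleGraph n) := by
  have hC := valid_codeQ8Cyc hn
  have hd := isGroupCode_q8Cyc hn
  rcases hn with rfl | rfl
  all_goals
    refine hC.isConnectedNormalBiCayley_of_numbering hd (g := numberingGP83Cycle _) ?_ ?_ ?_
    · simp [codeQ8Cyc]
    · decide +kernel
    · simp only [SimpleGraph.boxProd_adj]
      decide +kernel

/-! ### The groups given by presentations -/

/-- The coded elements form a subgroup containing the generators, hence are everything; they are
distinct because their images under `ψ` are. -/
theorem IsGroupCode.of_presentedGroup {α P : Type*} [Group P] {rels : Set (FreeGroup α)} {n : ℕ}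
    {mul : ℕ → ℕ → ℕ} {d : ℕ → PresentedGroup rels} (hn : 0 < n) (h0 : d 0 = 1)
    (hmul : ∀ i j, d (mul i j) = d i * d j)
    (hinv : ∀ i < n, (∀ j < n, mul i j < n) ∧ ∃ j < n, mul i j = 0)
    (hgen : ∀ x : α, ∃ i < n, d i = PresentedGroup.of x)
    (ψ : PresentedGroup rels →* P) (hinj : ∀ i < n, ∀ j < n, ψ (d i) = ψ (d j) → i = j) :
    IsGroupCode n mul d where
  inj i hi j hj h := hinj i hi j hj (by rw [h])
  surj := by
    let K : Subgroup (PresentedGroup rels) :=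
      { carrier := {h | ∃ i < n, d i = h}
        one_mem' := ⟨0, hn, h0⟩
        mul_mem' := by
          rintro _ _ ⟨i, hi, rfl⟩ ⟨j, hj, rfl⟩
          exact ⟨mul i j, (hinv i hi).1 j hj, hmul i j⟩
        inv_mem' := by
          rintro _ ⟨i, hi, rfl⟩
          obtain ⟨-, j, hj, hij⟩ := hinv i hi
          exact ⟨j, hj, by rw [eq_inv_iff_mul_eq_one, mul_eq_one_iff_eq_inv, eq_comm,
            inv_eq_iff_mul_eq_one, ← hmul, hij, h0]⟩ }
    have hK : K = ⊤ := by
      rw [eq_top_iff, ← PresentedGroup.closure_range_of, Subgroup.closure_le]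
      rintro _ ⟨x, rfl⟩
      exact hgen x
    intro h
    have : h ∈ K := hK ▸ Subgroup.mem_top h
    exact this
  mul_lt i hi := (hinv i hi).1
  map_mul i _ j _ := hmul i j

/-! ### Collecting powers into normal form -/

section
variable {G : Type*} [Group G] {a b c : G}

theorem pow_eq_pow_of_mod_eq {k m n : ℕ} (ha : a ^ k = 1) (h : m % k = n % k) : a ^ m = a ^ n := by
  rw [pow_eq_pow_mod m ha, h, ← pow_eq_pow_mod n ha]

theorem pow_mul_pow_of_mul_eq_mul_sq (hca : Commute c a) (hcb : Commute c b)
    (h : b * a = a * b * c ^ 2) (i j : ℕ) : b ^ j * a ^ i = a ^ i * b ^ j * c ^ (2 * (j * i)) := by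
  have h1 : ∀ j, b ^ j * a = a * b ^ j * c ^ (2 * j) := by
    intro j
    induction j with
    | zero => simp
    | succ j ih =>
      rw [pow_succ', mul_assoc, ih, ← mul_assoc, ← mul_assoc, h, mul_assoc (a * b),
        (hcb.pow_pow 2 j).eq, mul_add, mul_one, add_comm, pow_add]
      simp only [mul_assoc]
  induction i with
  | zero => simp
  | succ i ih =>
    rw [pow_succ, ← mul_assoc, ih, mul_assoc, (hca.pow_left _).eq, ← mul_assoc,
      mul_assoc (a ^ i), h1, mul_add, mul_one, mul_add, add_comm, pow_add]
    simp only [mul_assoc]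

/-- Moving `a ^ i'` past `b ^ j` costs `j * i'` central factors `c ^ 2`. This serves both the group
of order 16 with central `abc` and the group of order 27, where `c ^ 2 = c⁻¹`. -/
theorem mul_of_mul_eq_mul_sq (hca : Commute c a) (hcb : Commute c b) (h : b * a = a * b * c ^ 2)
    (i j k i' j' k' : ℕ) : a ^ i * b ^ j * c ^ k * (a ^ i' * b ^ j' * c ^ k') =
      a ^ (i + i') * b ^ (j + j') * c ^ (k + k' + 2 * (j * i')) := by
  have hk : Commute (c ^ k) (a ^ i' * b ^ j') := (hca.pow_pow _ _).mul_right (hcb.pow_pow _ _)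
  calc a ^ i * b ^ j * c ^ k * (a ^ i' * b ^ j' * c ^ k')
      = a ^ i * b ^ j * (c ^ k * (a ^ i' * b ^ j')) * c ^ k' := by simp only [mul_assoc]
    _ = a ^ i * (b ^ j * a ^ i') * b ^ j' * c ^ (k + k') := by
      rw [hk.eq, pow_add]; simp only [mul_assoc]
    _ = a ^ (i + i') * b ^ j * (c ^ (2 * (j * i')) * b ^ j') * c ^ (k + k') := by
      rw [pow_mul_pow_of_mul_eq_mul_sq hca hcb h, pow_add a]; simp only [mul_assoc]
    _ = a ^ (i + i') * b ^ (j + j') * c ^ (k + k' + 2 * (j * i')) := by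
      rw [(hcb.pow_pow _ _).eq, pow_add b, add_comm (k + k'), pow_add c _ (k + k')]
      simp only [mul_assoc]

theorem pow_mul_pow_of_mul_eq_pow_mul {k : ℕ} (h : b * a = a ^ k * b) (i j : ℕ) :
    b ^ j * a ^ i = a ^ (k ^ j * i) * b ^ j := by
  have h1 : ∀ i, b * a ^ i = a ^ (k * i) * b := fun i => by
    have : SemiconjBy b a (a ^ k) := h
    rw [pow_mul]
    exact (this.pow_right i).eq
  induction j generalizing i with
  | zero => simp
  | succ j ih => rw [pow_succ, mul_assoc, h1, ← mul_assoc, ih, pow_succ, mul_assoc, mul_assoc]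

end

/-- Combined with the `lift_rels…_iff` lemmas below, this yields the defining relations inside the
presented group. -/
theorem PresentedGroup.lift_of_eq_one {α : Type*} {rels : Set (FreeGroup α)} :
    ∀ r ∈ rels, FreeGroup.lift (PresentedGroup.of (rels := rels)) r = 1 := by
  intro r hr
  have : FreeGroup.lift (PresentedGroup.of (rels := rels)) = PresentedGroup.mk rels := by
    ext
    simp [PresentedGroup.of]
  rw [this]
  exact PresentedGroup.one_of_mem hr

section
variable {G : Type*} [Group G]

theorem lift_relsE4_iff (f : Fin 3 → G) : (∀ r ∈ relsE4, FreeGroup.lift f r = 1) ↔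
    f 0 ^ 2 = 1 ∧ f 1 ^ 2 = 1 ∧ f 2 ^ 2 = 1 ∧ f 0 * f 1 * f 2 = f 1 * f 2 * f 0 ∧
      f 1 * f 2 * f 0 = f 2 * f 0 * f 1 := by
  simp only [relsE4, Set.mem_insert_iff, Set.mem_singleton_iff, forall_eq_or_imp, forall_eq,
    map_mul, map_pow, map_inv, mul_inv_eq_one, FreeGroup.lift_apply_of]

theorem lift_relsE5_iff (f : Fin 2 → G) : (∀ r ∈ relsE5, FreeGroup.lift f r = 1) ↔
    f 0 ^ 8 = 1 ∧ f 1 ^ 2 = 1 ∧ f 1 * f 0 * f 1 = f 0 ^ 5 := by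
  simp only [relsE5, Set.mem_insert_iff, Set.mem_singleton_iff, forall_eq_or_imp, forall_eq,
    map_mul, map_pow, map_inv, mul_inv_eq_one, FreeGroup.lift_apply_of]

theorem lift_relsE6_iff (f : Fin 3 → G) : (∀ r ∈ relsE6, FreeGroup.lift f r = 1) ↔
    f 0 ^ 3 = 1 ∧ f 1 ^ 3 = 1 ∧ f 2 ^ 2 = 1 ∧ f 0 * f 1 = f 1 * f 0 ∧ (f 0 * f 2) ^ 2 = 1 ∧
      (f 1 * f 2) ^ 2 = 1 := by
  simp only [relsE6, Set.mem_insert_iff, Set.mem_singleton_iff, forall_eq_or_imp, forall_eq,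
    map_mul, map_pow, map_inv, mul_inv_eq_one, FreeGroup.lift_apply_of]

theorem lift_relsE7_iff (f : Fin 3 → G) : (∀ r ∈ relsE7, FreeGroup.lift f r = 1) ↔
    f 0 ^ 3 = 1 ∧ f 1 ^ 3 = 1 ∧ f 2 ^ 3 = 1 ∧ f 0 * f 2 = f 2 * f 0 ∧ f 1 * f 2 = f 2 * f 1 ∧
      f 2 = (f 0)⁻¹ * (f 1)⁻¹ * f 0 * f 1 := by
  simp only [relsE7, Set.mem_insert_iff, Set.mem_singleton_iff, forall_eq_or_imp, forall_eq,
    map_mul, map_pow, map_inv, mul_inv_eq_one, FreeGroup.lift_apply_of]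

end

/-! Faithful permutation representations: monomial or affine over `ℤ₄`, `ℤ₈` and `ℤ₃`. -/

def permE4 : Fin 3 → Equiv.Perm (ZMod 4 × ZMod 2)
  | 0 => ⟨fun p => (p.1, p.2 + 1), fun p => (p.1, p.2 + 1), by decide, by decide⟩
  | 1 => ⟨fun p => (if p.2 = 0 then p.1 else p.1 + 2, p.2),
      fun p => (if p.2 = 0 then p.1 else p.1 + 2, p.2), by decide, by decide⟩
  | 2 => ⟨fun p => (if p.2 = 0 then p.1 + 3 else p.1 + 1, p.2 + 1),
      fun p => (if p.2 = 0 then p.1 + 3 else p.1 + 1, p.2 + 1), by decide, by decide⟩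

def permE5 : Fin 2 → Equiv.Perm (ZMod 8)
  | 0 => ⟨fun p => p + 1, fun p => p - 1, by decide, by decide⟩
  | 1 => ⟨fun p => 5 * p, fun p => 5 * p, by decide, by decide⟩

def permE6 : Fin 3 → Equiv.Perm (ZMod 3 × ZMod 3)
  | 0 => ⟨fun p => (p.1 + 1, p.2), fun p => (p.1 - 1, p.2), by decide, by decide⟩
  | 1 => ⟨fun p => (p.1, p.2 + 1), fun p => (p.1, p.2 - 1), by decide, by decide⟩
  | 2 => ⟨fun p => (-p.1, -p.2), fun p => (-p.1, -p.2), by decide, by decide⟩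

def permE7 : Fin 3 → Equiv.Perm (ZMod 3 × ZMod 3)
  | 0 => ⟨fun p => (p.1, p.2 + 1), fun p => (p.1, p.2 - 1), by decide, by decide⟩
  | 1 => ⟨fun p => (p.1 + p.2, p.2), fun p => (p.1 - p.2, p.2), by decide, by decide⟩
  | 2 => ⟨fun p => (p.1 - 1, p.2), fun p => (p.1 + 1, p.2), by decide, by decide⟩

theorem lift_permE4 : ∀ r ∈ relsE4, FreeGroup.lift permE4 r = 1 :=
  (lift_relsE4_iff _).2 (by decide +kernel)

theorem lift_permE5 : ∀ r ∈ relsE5, FreeGroup.lift permE5 r = 1 :=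
  (lift_relsE5_iff _).2 (by decide +kernel)

theorem lift_permE6 : ∀ r ∈ relsE6, FreeGroup.lift permE6 r = 1 :=
  (lift_relsE6_iff _).2 (by decide +kernel)

theorem lift_permE7 : ∀ r ∈ relsE7, FreeGroup.lift permE7 r = 1 :=
  (lift_relsE7_iff _).2 (by decide +kernel)

/-! ### Normal forms in the presented groups -/

def decodeE4 (i : ℕ) : GroupE4 :=
  let a : GroupE4 := PresentedGroup.of 0
  let b : GroupE4 := PresentedGroup.of 1
  let c : GroupE4 := PresentedGroup.of 2
  a ^ i * b ^ (i / 2) * (a * b * c) ^ (i / 4)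

def decodeE5 (i : ℕ) : GroupE5 :=
  let a : GroupE5 := PresentedGroup.of 0
  let b : GroupE5 := PresentedGroup.of 1
  a ^ i * b ^ (i / 8)

def decodeE6 (i : ℕ) : GroupE6 :=
  let a : GroupE6 := PresentedGroup.of 0
  let b : GroupE6 := PresentedGroup.of 1
  let c : GroupE6 := PresentedGroup.of 2
  a ^ i * b ^ (i / 3) * c ^ (i / 9)

def decodeE7 (i : ℕ) : GroupE7 :=
  let a : GroupE7 := PresentedGroup.of 0
  let b : GroupE7 := PresentedGroup.of 1
  let c : GroupE7 := PresentedGroup.of 2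
  a ^ i * b ^ (i / 3) * c ^ (i / 9)

theorem decodeE7_mulE7 (x y : ℕ) : decodeE7 (mulE7 x y) = decodeE7 x * decodeE7 y := by
  obtain ⟨ha, hb, hc, hac, hbc, habc⟩ := (lift_relsE7_iff _).1 PresentedGroup.lift_of_eq_one
  have hba : (PresentedGroup.of 1 * PresentedGroup.of 0 : GroupE7) =
      PresentedGroup.of 0 * PresentedGroup.of 1 * PresentedGroup.of 2 ^ 2 := by
    have h1 : (PresentedGroup.of 0 * PresentedGroup.of 1 : GroupE7) =
        PresentedGroup.of 1 * PresentedGroup.of 0 * PresentedGroup.of 2 := by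
      rw [habc]
      group
    rw [h1, mul_assoc, ← pow_succ', hc, mul_one]
  simp only [decodeE7]
  rw [mul_of_mul_eq_mul_sq hac.symm hbc.symm hba, mulE7]
  congr 1
  · congr 1
    · exact pow_eq_pow_of_mod_eq ha (by omega)
    · exact pow_eq_pow_of_mod_eq hb (by omega)
  · refine pow_eq_pow_of_mod_eq hc ?_
    generalize x / 9 + y / 9 + 2 * (x / 3 * y) = t
    omega

/-- The cyclic relations make `z` commute with `a` and `b`. From `z² = (abc)(cab) = (ab)²`,
conjugation by `a` gives `z² = (ba)²`; as `ab` and `ba` are inverse to each other, `z⁴ = 1`. The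
rest follows by cancelling. -/
theorem center_of_relsE4 {G : Type*} [Group G] {a b c z : G} (ha : a ^ 2 = 1) (hb : b ^ 2 = 1)
    (hc : c ^ 2 = 1) (hz : a * b * c = z) (hz' : z = b * c * a) (hz'' : z = c * a * b) :
    Commute z a ∧ Commute z b ∧ z ^ 4 = 1 ∧ b * a = a * b * z ^ 2 ∧ a * b * z ^ 3 = c := by
  have hza : Commute z a := by
    have h : a * (b * c * a) = a * b * c * a := by simp only [mul_assoc]
    rw [← hz', hz] at h
    exact h.symm
  have hzb : Commute z b := by
    have h : b * (c * a * b) = b * c * a * b := by simp only [mul_assoc]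
    rw [← hz', ← hz''] at h
    exact h.symm
  have hbaab : b * a * (a * b) = 1 := by
    rw [mul_assoc, ← mul_assoc a, ← sq a, ha, one_mul, ← sq, hb]
  have habba : a * b * (b * a) = 1 := by
    rw [mul_assoc, ← mul_assoc b, ← sq b, hb, one_mul, ← sq, ha]
  have hzab : z ^ 2 = (a * b) ^ 2 := by
    calc z ^ 2 = (a * b * c) * (c * (a * b)) := by rw [hz, ← mul_assoc c, ← hz'', sq]
      _ = a * b * c ^ 2 * (a * b) := by rw [sq]; simp only [mul_assoc]
      _ = (a * b) ^ 2 := by rw [hc, mul_one, sq]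
  have hzba : z ^ 2 = (b * a) ^ 2 := by
    calc z ^ 2 = a * z ^ 2 * a := by rw [← (hza.pow_left 2).eq, mul_assoc, ← sq, ha, mul_one]
      _ = a ^ 2 * (b * a) ^ 2 := by rw [hzab, sq, sq, sq]; simp only [mul_assoc]
      _ = (b * a) ^ 2 := by rw [ha, one_mul]
  have hz4 : z ^ 4 = 1 := by
    calc z ^ 4 = z ^ 2 * z ^ 2 := by rw [← pow_add]
      _ = (b * a) ^ 2 * (a * b) ^ 2 := by rw [← hzba, ← hzab]
      _ = b * a * (b * a * (a * b)) * (a * b) := by rw [sq, sq]; simp only [mul_assoc]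
      _ = 1 := by rw [hbaab, mul_one, hbaab]
  refine ⟨hza, hzb, hz4, ?_, ?_⟩
  · rw [hzba, sq, ← mul_assoc, habba, one_mul]
  · have hc' : c * (a * b * z ^ 3) = 1 := by
      rw [← mul_assoc, ← mul_assoc c, ← hz'', ← pow_succ', hz4]
    rw [← mul_right_inj c, hc', ← sq, hc]

theorem decodeE4_mulE4 (x y : ℕ) : decodeE4 (mulE4 x y) = decodeE4 x * decodeE4 y := by
  obtain ⟨ha, hb, hc, hz, hz'⟩ := (lift_relsE4_iff _).1 PresentedGroup.lift_of_eq_one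
  obtain ⟨hza, hzb, hz4, hba, -⟩ := center_of_relsE4 ha hb hc rfl hz (hz.trans hz')
  simp only [decodeE4]
  rw [mul_of_mul_eq_mul_sq hza hzb hba, mulE4]
  congr 1
  · congr 1
    · exact pow_eq_pow_of_mod_eq ha (by omega)
    · exact pow_eq_pow_of_mod_eq hb (by omega)
  · refine pow_eq_pow_of_mod_eq hz4 ?_
    generalize x / 4 + y / 4 + 2 * (x / 2 * y) = t
    omega

theorem decodeE5_mulE5 (x y : ℕ) : decodeE5 (mulE5 x y) = decodeE5 x * decodeE5 y := by
  obtain ⟨ha, hb, hbab⟩ := (lift_relsE5_iff _).1 PresentedGroup.lift_of_eq_one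
  simp only [decodeE5]
  generalize (PresentedGroup.of 0 : GroupE5) = a at *
  generalize (PresentedGroup.of 1 : GroupE5) = b at *
  have hba : b * a = a ^ 5 * b := by rw [← hbab, mul_assoc, ← sq, hb, mul_one]
  rw [mul_assoc, ← mul_assoc (b ^ _), pow_mul_pow_of_mul_eq_pow_mul hba, mul_assoc, ← mul_assoc,
    ← pow_add, ← pow_add, mulE5]
  congr 1
  · refine pow_eq_pow_of_mod_eq ha ?_
    generalize x + 5 ^ (x / 8) * y = t
    omega
  · refine pow_eq_pow_of_mod_eq hb ?_
    generalize x + 5 ^ (x / 8) * y = t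
    omega

theorem decodeE6_mulE6 (x y : ℕ) : decodeE6 (mulE6 x y) = decodeE6 x * decodeE6 y := by
  obtain ⟨ha, hb, hc, hab, hac, hbc⟩ := (lift_relsE6_iff _).1 PresentedGroup.lift_of_eq_one
  simp only [decodeE6]
  generalize (PresentedGroup.of 0 : GroupE6) = a at *
  generalize (PresentedGroup.of 1 : GroupE6) = b at *
  generalize (PresentedGroup.of 2 : GroupE6) = c at *
  have hconj : ∀ g : GroupE6, g ^ 3 = 1 → (g * c) ^ 2 = 1 → c * g = g ^ 2 * c := by
    intro g hg hgc
    have h1 : g * (c * g * c) = 1 := by rw [← hgc, sq]; simp only [mul_assoc]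
    have h2 : g * g ^ 2 = 1 := by rw [← pow_succ', hg]
    have h3 : c * g * c = g ^ 2 := mul_left_cancel (h1.trans h2.symm)
    rw [← h3, mul_assoc, ← sq, hc, mul_one]
  have hab' : Commute a b := hab
  have key : ∀ i j k i' j' k', a ^ i * b ^ j * c ^ k * (a ^ i' * b ^ j' * c ^ k') =
      a ^ (i + 2 ^ k * i') * b ^ (j + 2 ^ k * j') * c ^ (k + k') := by
    intro i j k i' j' k'
    calc a ^ i * b ^ j * c ^ k * (a ^ i' * b ^ j' * c ^ k')
        = a ^ i * b ^ j * (c ^ k * a ^ i') * b ^ j' * c ^ k' := by simp only [mul_assoc]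
      _ = a ^ i * (b ^ j * a ^ (2 ^ k * i')) * (c ^ k * b ^ j') * c ^ k' := by
        rw [pow_mul_pow_of_mul_eq_pow_mul (hconj a ha hac)]; simp only [mul_assoc]
      _ = _ := by
        rw [pow_mul_pow_of_mul_eq_pow_mul (hconj b hb hbc), ← (hab'.pow_pow _ _).eq, pow_add,
          pow_add, pow_add]
        simp only [mul_assoc]
  rw [key, mulE6]
  generalize x + 2 ^ (x / 9) * y = s
  generalize x / 3 + 2 ^ (x / 9) * (y / 3) = t
  congr 1
  · congr 1
    · exact pow_eq_pow_of_mod_eq ha (by omega)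
    · exact pow_eq_pow_of_mod_eq hb (by omega)
  · exact pow_eq_pow_of_mod_eq hc (by omega)

theorem decodeE4_gens : decodeE4 1 = PresentedGroup.of 0 ∧ decodeE4 2 = PresentedGroup.of 1 ∧
    decodeE4 15 = PresentedGroup.of 2 := by
  obtain ⟨ha, hb, hc, hz, hz'⟩ := (lift_relsE4_iff _).1 PresentedGroup.lift_of_eq_one
  refine ⟨by simp [decodeE4], by simp [decodeE4, ha], ?_⟩
  obtain ⟨-, -, -, -, h⟩ := center_of_relsE4 ha hb hc rfl hz (hz.trans hz')
  simp only [decodeE4]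
  -- Here `15 = 1 + 2 + 4 * 3` codes `a b z³ = c`; exponents in `decodeE4` are unreduced, so those
  -- of `a` and `b` drop to `1` only now.
  rw [pow_eq_pow_of_mod_eq (m := 15) (n := 1) ha rfl,
    pow_eq_pow_of_mod_eq (m := 15 / 2) (n := 1) hb rfl, pow_one, pow_one]
  exact h

theorem decodeE5_gens : decodeE5 1 = PresentedGroup.of 0 ∧ decodeE5 8 = PresentedGroup.of 1 := by
  obtain ⟨ha, -⟩ := (lift_relsE5_iff _).1 PresentedGroup.lift_of_eq_one
  exact ⟨by simp [decodeE5], by simp [decodeE5, ha]⟩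

theorem decodeE6_gens : decodeE6 1 = PresentedGroup.of 0 ∧ decodeE6 3 = PresentedGroup.of 1 ∧
    decodeE6 9 = PresentedGroup.of 2 := by
  obtain ⟨ha, hb, -⟩ := (lift_relsE6_iff _).1 PresentedGroup.lift_of_eq_one
  exact ⟨by simp [decodeE6], by simp [decodeE6, ha],
    by simp [decodeE6, hb, pow_eq_pow_of_mod_eq (n := 0) ha]⟩

theorem decodeE7_gens : decodeE7 1 = PresentedGroup.of 0 ∧ decodeE7 3 = PresentedGroup.of 1 ∧
    decodeE7 9 = PresentedGroup.of 2 := by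
  obtain ⟨ha, hb, -⟩ := (lift_relsE7_iff _).1 PresentedGroup.lift_of_eq_one
  exact ⟨by simp [decodeE7], by simp [decodeE7, ha],
    by simp [decodeE7, hb, pow_eq_pow_of_mod_eq (n := 0) ha]⟩

theorem isGroupCode_E4 : IsGroupCode 16 mulE4 decodeE4 := by
  obtain ⟨h0, h1, h2⟩ := decodeE4_gens
  refine .of_presentedGroup (by omega) (by simp [decodeE4]) decodeE4_mulE4 (by decide +kernel) ?_
    (PresentedGroup.toGroup lift_permE4) ?_
  · intro x
    fin_cases x
    exacts [⟨1, by omega, h0⟩, ⟨2, by omega, h1⟩, ⟨15, by omega, h2⟩]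
  · simp only [decodeE4, map_mul, map_pow, PresentedGroup.toGroup.of]
    decide +kernel

theorem isGroupCode_E5 : IsGroupCode 16 mulE5 decodeE5 := by
  obtain ⟨h0, h1⟩ := decodeE5_gens
  refine .of_presentedGroup (by omega) (by simp [decodeE5]) decodeE5_mulE5 (by decide +kernel) ?_
    (PresentedGroup.toGroup lift_permE5) ?_
  · intro x
    fin_cases x
    exacts [⟨1, by omega, h0⟩, ⟨8, by omega, h1⟩]
  · simp only [decodeE5, map_mul, map_pow, PresentedGroup.toGroup.of]
    decide +kernel

theorem isGroupCode_E6 : IsGroupCode 18 mulE6 decodeE6 := by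
  obtain ⟨h0, h1, h2⟩ := decodeE6_gens
  refine .of_presentedGroup (by omega) (by simp [decodeE6]) decodeE6_mulE6 (by decide +kernel) ?_
    (PresentedGroup.toGroup lift_permE6) ?_
  · intro x
    fin_cases x
    exacts [⟨1, by omega, h0⟩, ⟨3, by omega, h1⟩, ⟨9, by omega, h2⟩]
  · simp only [decodeE6, map_mul, map_pow, PresentedGroup.toGroup.of]
    decide +kernel

theorem isGroupCode_E7 : IsGroupCode 27 mulE7 decodeE7 := by
  obtain ⟨h0, h1, h2⟩ := decodeE7_gens
  refine .of_presentedGroup (by omega) (by simp [decodeE7]) decodeE7_mulE7 (by decide +kernel) ?_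
    (PresentedGroup.toGroup lift_permE7) ?_
  · intro x
    fin_cases x
    exacts [⟨1, by omega, h0⟩, ⟨3, by omega, h1⟩, ⟨9, by omega, h2⟩]
  · simp only [decodeE7, map_mul, map_pow, PresentedGroup.toGroup.of]
    decide +kernel

/-! ### The connection sets -/

theorem image_mem_nil {α : Type*} (d : ℕ → α) : d '' {s | s ∈ ([] : List ℕ)} = ∅ := by
  simp

theorem image_mem_cons {α : Type*} (d : ℕ → α) (i : ℕ) (l : List ℕ) :
    d '' {s | s ∈ i :: l} = insert (d i) (d '' {s | s ∈ l}) := by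
  ext x
  simp [eq_comm]

theorem connE4_eq : connE4 = decodeE4 '' {s | s ∈ [1, 2, 15]} := by
  obtain ⟨h0, h1, h2⟩ := decodeE4_gens
  simp only [image_mem_cons, image_mem_nil, insert_empty_eq, h0, h1, h2, connE4]

theorem connE5_eq : connE5 = decodeE5 '' {s | s ∈ [1, 7, 8, 4, 12]} := by
  obtain ⟨h0, h1⟩ := decodeE5_gens
  have h4 : decodeE5 4 = decodeE5 1 ^ 4 := by simp [decodeE5]
  have h7 : decodeE5 7 = (decodeE5 1)⁻¹ :=
    eq_inv_of_mul_eq_one_left ((decodeE5_mulE5 7 1).symm.trans (by simp [mulE5, decodeE5]))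
  have h12 : decodeE5 12 = decodeE5 4 * decodeE5 8 := decodeE5_mulE5 4 8
  simp only [image_mem_cons, image_mem_nil, insert_empty_eq, h12, h7, h4, h0, h1, connE5]

theorem connE6_eq : connE6 = decodeE6 '' {s | s ∈ [9, 11, 15, 17]} := by
  obtain ⟨h0, h1, h2⟩ := decodeE6_gens
  have h11 : decodeE6 11 = decodeE6 9 * decodeE6 1 := decodeE6_mulE6 9 1
  have h15 : decodeE6 15 = decodeE6 9 * decodeE6 3 := decodeE6_mulE6 9 3
  have h17 : decodeE6 17 = decodeE6 11 * decodeE6 3 := decodeE6_mulE6 11 3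
  simp only [image_mem_cons, image_mem_nil, insert_empty_eq, h17, h15, h11, h0, h1, h2, connE6]

theorem connE7_eq : connE7 = decodeE7 '' {s | s ∈ [1, 3, 2, 6]} := by
  obtain ⟨h0, h1, -⟩ := decodeE7_gens
  have h2 : decodeE7 2 = (decodeE7 1)⁻¹ :=
    eq_inv_of_mul_eq_one_left ((decodeE7_mulE7 2 1).symm.trans (by simp [mulE7, decodeE7]))
  have h6 : decodeE7 6 = (decodeE7 3)⁻¹ :=
    eq_inv_of_mul_eq_one_left ((decodeE7_mulE7 6 3).symm.trans (by simp [mulE7, decodeE7]))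
  simp only [image_mem_cons, image_mem_nil, insert_empty_eq, h2, h6, h0, h1, connE7]

theorem lemma4p5 :
    (∀ (G : Type*) [Group G], IsClassE G →
      ∃ R L S : Set G, IsBiCayTriple R L S ∧ (biCayGraph R L S).Connected ∧
        (biCayBR R L S).Normal) ∧
    (∀ n : ℕ, n = 2 ∨ n = 3 ∨ n = 4 →
      IsConnectedNormalBiCayley (ElemAb2 n) (hypercube (n + 1))) ∧
    (∀ n : ℕ, n = 3 ∨ n = 4 ∨ n = 5 →
      IsConnectedNormalBiCayley (DihedralGroup n) (SimpleGraph.cycleGraph (2 * n) □ graphK2)) ∧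
    IsConnectedNormalBiCayley (alternatingGroup (Fin 4)) (cayGraph connA4 □ graphK2) ∧
    IsConnectedNormalBiCayley GroupE4 (cayGraph connE4 □ graphK2) ∧
    IsConnectedNormalBiCayley GroupE5 (cayGraph connE5 □ graphK2) ∧
    IsConnectedNormalBiCayley GroupE6 (cayGraph connE6 □ graphK2) ∧
    IsConnectedNormalBiCayley GroupE7 (cayGraph connE7 □ graphK2) ∧
    (∀ n : ℕ, n = 3 ∨ n = 4 →
      IsConnectedNormalBiCayley (QuaternionGroup 2 × Cyc n)
        (graphGP83 □ SimpleGraph.cycleGraph n)) := by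
  have h3 := isConnectedNormalBiCayley_prism valid_codeAlt4 isGroupCode_alt4 connA4_eq
  have h4 := isConnectedNormalBiCayley_prism valid_codeE4 isGroupCode_E4 connE4_eq
  have h5 := isConnectedNormalBiCayley_prism valid_codeE5 isGroupCode_E5 connE5_eq
  have h6 := isConnectedNormalBiCayley_prism valid_codeE6 isGroupCode_E6 connE6_eq
  have h7 := isConnectedNormalBiCayley_prism valid_codeE7 isGroupCode_E7 connE7_eq
  refine ⟨fun G _ hG => ?_, fun n hn => isConnectedNormalBiCayley_hypercube hn,
    fun n hn => isConnectedNormalBiCayley_cycle_prism hn, h3, h4, h5, h6, h7,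
    fun n hn => isConnectedNormalBiCayley_GP83_cycle hn⟩
  cases hG with
  | elemAb n hn e => exact (isConnectedNormalBiCayley_hypercube hn).exists_of_mulEquiv e
  | dihedral n hn e => exact (isConnectedNormalBiCayley_cycle_prism hn).exists_of_mulEquiv e
  | alt4 e => exact h3.exists_of_mulEquiv e
  | e4 e => exact h4.exists_of_mulEquiv e
  | e5 e => exact h5.exists_of_mulEquiv e
  | e6 e => exact h6.exists_of_mulEquiv e
  | e7 e => exact h7.exists_of_mulEquiv e
  | quat n hn e => exact (isConnectedNormalBiCayley_GP83_cycle hn).exists_of_mulEquiv e
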